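/- Let $n\ge 1$, $\alpha\in(0,1)$ and \[ \mu_{n,\alpha}=2^\alpha\pi^{-n/2}\,\frac{\Gamma\left(\frac{n+\alpha+1}{2}\right)}{\Gamma\left(\frac{1-\alpha}{2}\right)} . \] For $f\colon\mathbb R^n\to\mathbb R$ and $\varphi\colon\mathbb R^n\to\mathbb R^n$ let, whenever the integrals converge absolutely, \[ \nabla^\alpha f(x)=\mu_{n,\alpha}\int_{\mathbb R^n}\frac{(f(y)-f(x))(y-x)}{|y-x|^{n+\alpha+1}}\,dy, \qquad \operatorname{div}^\alpha\varphi(x)=\mu_{n,\alpha}\int_{\mathbb R^n}\frac{(\varphi(y)-\varphi(x))\cdot(y-x)}{|y-x|^{n+\alpha+1}}\,dy . \] For a measurable set $E\subset\mathbb R^n$, write $\chi_E\in BV^{\alpha,\infty}_{\rm loc}(\mathbb R^n)$ if, for every relatively compact open set $A$, the supremum of $\int_E\operatorname{div}^\alpha\varphi\,dx$ over all $\varphi\in C^\infty_c(\mathbb R^n;\mathbb R^n)$ with $|\varphi|\le1$ and $\operatorname{supp}\varphi\subset A$ is finite. In this case $D^\alpha\chi_E$ denotes the (unique) $\mathbb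 R^n$-valued Radon measure with $\int_E\operatorname{div}^\alpha\varphi\,dx=-\int\varphi\cdot dD^\alpha\chi_E$ for all $\varphi\in C^\infty_c(\mathbb R^n;\mathbb R^n)$, and $|D^\alpha\chi_E|$ its total variation. The fractional reduced boundary $\mathscr F^\alpha E$ is the set of all $x\in\operatorname{supp}|D^\alpha\chi_E|$ for which the limit \[ \nu^\alpha_E(x)=\lim_{\rho\to0^+}\frac{D^\alpha\chi_E(B_\rho(x))}{|D^\alpha\chi_E|(B_\rho(x))} \] exists and is a unit vector. The effective fractional reduced boundary is $\mathscr F^\alpha_{\rm e}E=\mathscr F^\alpha E\cap\partial^*E$, where $\partial^*E=\mathbb R^n\setminus(E^0\cup E^1)$ and $E^t$ is the set of points at which $E$ has Lebesgue density $t$. **Proposition (Ball).** Let $x_0\in\mathbb R^n$ and $r>0$. For every $x\notin\partial B_r(x_0)$ the integral defining $\nabla^\alpha\chi_{B_r(x_0)}(x)$ and the one on the right-hand side below converge absolutely, and \[ \nabla^\alpha\chi_{B_r(x_0)}(x)=-\frac{\mu_{n,\alpha}}{n+\alpha-1}\int_{\partial B_r(x_0)}\frac{y-x_0}{r}\,\frac{1}{|x-y|^{n+\alpha-1}}\,d\mathscr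 H^{n-1}(y). \] Moreover, $\chi_{B_r(x_0)}\in BV^{\alpha,\infty}_{\rm loc}(\mathbb R^n)$, the measure $D^\alpha\chi_{B_r(x_0)}$ exists, $\mathscr F^\alpha B_r(x_0)=\mathbb R^n\setminus\{x_0\}$, $\mathscr F^\alpha_{\rm e}B_r(x_0)=\partial B_r(x_0)$, and \[ \nu^\alpha_{B_r(x_0)}(x)=-\frac{x-x_0}{|x-x_0|}\qquad\text{for all }x\ne x_0 . \] -/

import Mathlib

open MeasureTheory Filter Set Metric
open scoped Topology ContDiff

noncomputable section

namespace FractionalBV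

/-- The space `ℝⁿ` with its Euclidean norm. -/
abbrev Rn (n : ℕ) : Type := EuclideanSpace ℝ (Fin n)

/-- The renormalization constant
`μ_{n,α} = 2^α π^{-n/2} Γ((n+α+1)/2) / Γ((1-α)/2)`. -/
def muConst (n : ℕ) (α : ℝ) : ℝ :=
  (2 : ℝ) ^ α * Real.pi ^ (-(n : ℝ) / 2) *
    (Real.Gamma (((n : ℝ) + α + 1) / 2) / Real.Gamma ((1 - α) / 2))

/-- The integrand `y ↦ (f(y) - f(x)) (y - x) / |y - x|^{n+α+1}` of the fractional gradient. -/
def fracGradIntegrand {n : ℕ} (α : ℝ) (f : Rn n → ℝ) (x : Rn n) : Rn n → Rn n :=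
  fun y => ((f y - f x) / ‖y - x‖ ^ ((n : ℝ) + α + 1)) • (y - x)

/-- The fractional `α`-gradient `∇^α f(x)`. -/
def fracGrad {n : ℕ} (α : ℝ) (f : Rn n → ℝ) (x : Rn n) : Rn n :=
  muConst n α • ∫ y, fracGradIntegrand α f x y

/-- The fractional `α`-divergence `div^α φ(x)`. -/
def fracDiv {n : ℕ} (α : ℝ) (φ : Rn n → Rn n) (x : Rn n) : ℝ :=
  muConst n α * ∫ y, inner ℝ (φ y - φ x) (y - x) / ‖y - x‖ ^ ((n : ℝ) + α + 1)

/-- `f ∈ BV^{α,p}_loc(ℝⁿ)`: `f ∈ L^p(ℝⁿ)` and, for every relatively compact open set `A`, the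
integrals `∫ f div^α φ`, with `φ ∈ C_c^∞(ℝⁿ;ℝⁿ)`, `|φ| ≤ 1` and `supp φ ⊂ A`, are bounded above. -/
def MemBVLoc {n : ℕ} (α : ℝ) (p : ENNReal) (f : Rn n → ℝ) : Prop :=
  MemLp f p volume ∧
    ∀ A : Set (Rn n), IsOpen A → IsCompact (closure A) →
      BddAbove {t : ℝ | ∃ φ : Rn n → Rn n, ContDiff ℝ ∞ φ ∧ HasCompactSupport φ ∧
        (∀ x, ‖φ x‖ ≤ 1) ∧ tsupport φ ⊆ A ∧ t = ∫ x, f x * fracDiv α φ x}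

/-- An `ℝⁿ`-valued (locally finite) Radon measure `D` on `ℝⁿ`, given by its polar decomposition
`D = σ |D|`: `variation` is the total variation measure `|D|`, and `density` is the Borel field
`σ`, of unit length `|D|`-almost everywhere. -/
structure VectorRadonMeasure (n : ℕ) where
  variation : Measure (Rn n)
  locallyFinite : IsLocallyFiniteMeasure variation
  density : Rn n → Rn n
  measurable_density : Measurable density
  norm_density : ∀ᵐ x ∂variation, ‖density x‖ = 1

/-- The zero vector measure. -/
instance (n : ℕ) : Inhabited (VectorRadonMeasure n) :=
  ⟨{ variation := 0
     locallyFinite := inferInstance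
     density := fun _ => 0
     measurable_density := measurable_const
     norm_density := by simp }⟩

/-- The value `D(A) = ∫_A σ d|D|` on a bounded Borel set `A`. -/
def VectorRadonMeasure.value {n : ℕ} (D : VectorRadonMeasure n) (A : Set (Rn n)) : Rn n :=
  ∫ x in A, D.density x ∂D.variation

/-- `D` is the fractional `α`-variation measure of `f`:
`∫ f div^α φ dx = - ∫ φ · dD` for all `φ ∈ C_c^∞(ℝⁿ;ℝⁿ)`. -/
def IsFracVariation {n : ℕ} (α : ℝ) (f : Rn n → ℝ) (D : VectorRadonMeasure n) : Prop :=
  ∀ φ : Rn n → Rn n, ContDiff ℝ ∞ φ → HasCompactSupport φ →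
    ∫ x, f x * fracDiv α φ x = - ∫ x, inner ℝ (φ x) (D.density x) ∂D.variation

open Classical in
/-- The fractional `α`-variation measure `D^α f` (the zero measure if there is none). It is
determined by `f`: `|D^α f|` uniquely, and its density up to `|D^α f|`-null sets. -/
def fracVariation {n : ℕ} (α : ℝ) (f : Rn n → ℝ) : VectorRadonMeasure n :=
  if h : ∃ D, IsFracVariation α f D then Classical.choose h else default

/-- The characteristic function `χ_E`. -/
def chi {n : ℕ} (E : Set (Rn n)) : Rn n → ℝ := E.indicator fun _ => 1

/-- The quotient `D^αχ_E(B_ρ(x)) / |D^αχ_E|(B_ρ(x))`. -/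
def normalQuotient {n : ℕ} (α : ℝ) (E : Set (Rn n)) (x : Rn n) (ρ : ℝ) : Rn n :=
  ((fracVariation α (chi E)).variation.real (ball x ρ))⁻¹ •
    (fracVariation α (chi E)).value (ball x ρ)

/-- The fractional reduced boundary of `E`: the points `x` of `supp |D^αχ_E|` at which the
quotients `D^αχ_E(B_ρ(x)) / |D^αχ_E|(B_ρ(x))` converge, as `ρ → 0⁺`, to a unit vector. -/
def fracReducedBoundary {n : ℕ} (α : ℝ) (E : Set (Rn n)) : Set (Rn n) :=
  {x | x ∈ (fracVariation α (chi E)).variation.support ∧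
    ∃ ν : Rn n, ‖ν‖ = 1 ∧ Tendsto (normalQuotient α E x) (𝓝[>] 0) (𝓝 ν)}

/-- The inner unit fractional normal `ν^α_E(x)`, the limit of the quotients above; meaningful for
`x` in the fractional reduced boundary. -/
def fracNormal {n : ℕ} (α : ℝ) (E : Set (Rn n)) (x : Rn n) : Rn n :=
  limUnder (𝓝[>] 0) (normalQuotient α E x)

/-- The set `E^t` of points of density `t` of `E`. -/
def densityPoints {n : ℕ} (E : Set (Rn n)) (t : ℝ) : Set (Rn n) :=
  {x | Tendsto (fun ρ : ℝ => volume.real (E ∩ ball x ρ) / volume.real (ball x ρ))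
    (𝓝[>] 0) (𝓝 t)}

/-- The measure-theoretic boundary `∂*E = ℝⁿ \ (E⁰ ∪ E¹)`. -/
def essBoundary {n : ℕ} (E : Set (Rn n)) : Set (Rn n) :=
  (densityPoints E 0 ∪ densityPoints E 1)ᶜ

/-- The effective fractional reduced boundary of `E`. -/
def effFracReducedBoundary {n : ℕ} (α : ℝ) (E : Set (Rn n)) : Set (Rn n) :=
  fracReducedBoundary α E ∩ essBoundary E

end FractionalBV

end

namespace FractionalBV

open scoped NNReal ENNReal Pointwise

/-! ### Surface measure of the sphere as Hausdorff measure -/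

section SphereMeasure

/-! The kernel `z / |z|^(n+α+1)` is `-1/(n+α-1)` times the gradient of `|z|^(-(n+α-1))`. When `x` is
off the sphere, the integrand of the fractional gradient vanishes near `x`, so the divergence
theorem applies: on the ball if `x` is outside, on its complement if `x` is inside, where the
boundary term at radius `k` is `O(k^(-α))`. This gives the surface formula
(`fracGrad_ball_eq_integral_sphere`). The divergence theorem (`integral_ball_lineDeriv`) comes from
polar coordinates, hence in terms of `toSphere`; a comparison of thin sectors with cylinders over
their tangential projections identifies `toSphere` with the Hausdorff measure.

Symmetry determines the direction of the gradient. The reflection fixing `x - x₀` makes it radial,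
and pairing mirror points across the hyperplane orthogonal to `x - x₀` makes it point strictly
inward (`exists_fracGrad_ball_eq_neg_smul`).

Translating the ball by `w` changes its indicator by `O(min |w| 1)` in `L¹`. Fubini then gives both
`∇^α χ ∈ L¹` and integration by parts (`integral_mul_fracDiv`), so `∇^α χ dx` is a fractional
variation. By uniqueness of vector Radon measures, the measure chosen in `fracVariation` is this
one. It has positive density almost everywhere, hence full support, and its polar field is the
inward radial field, continuous off `x₀`. So the quotients converge to that field for `x ≠ x₀`,
while at `x₀` they vanish by oddness. Intersecting with the sphere, which is the essential boundary,
gives the effective reduced boundary. -/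

theorem euclideanHausdorffMeasure_image_le_of_edist_le {ι X Y : Type*}
    [EMetricSpace X] [MeasurableSpace X] [BorelSpace X]
    [EMetricSpace Y] [MeasurableSpace Y] [BorelSpace Y] {f : ι → X} {g : ι → Y} {S : Set ι}
    {K : ℝ≥0} (h : ∀ i ∈ S, ∀ j ∈ S, edist (f i) (f j) ≤ K * edist (g i) (g j)) (d : ℕ) :
    μHE[d] (f '' S) ≤ (K : ℝ≥0∞) ^ d * μHE[d] (g '' S) := by
  classical
  rcases S.eq_empty_or_nonempty with rfl | ⟨i₀, _⟩
  · simp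
  have : Nonempty ι := ⟨i₀⟩
  -- The bound forces `f` to be constant on the fibres of `g` in `S`, so `f` factors through `g` by
  -- a `K`-Lipschitz map, whichever preimages are chosen.
  set F : Y → X := fun y => f (Function.invFunOn g S y) with hF
  have hmem : ∀ i ∈ S, Function.invFunOn g S (g i) ∈ S := fun i hi =>
    Function.invFunOn_mem ⟨i, hi, rfl⟩
  have heq : ∀ i ∈ S, g (Function.invFunOn g S (g i)) = g i := fun i hi =>
    Function.invFunOn_eq ⟨i, hi, rfl⟩
  have hLip : LipschitzOnWith K F (g '' S) := by
    rintro _ ⟨i, hi, rfl⟩ _ ⟨j, hj, rfl⟩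
    have := h _ (hmem i hi) _ (hmem j hj)
    rwa [heq i hi, heq j hj] at this
  have hsub : f '' S ⊆ F '' (g '' S) := by
    rintro _ ⟨i, hi, rfl⟩
    refine ⟨g i, ⟨i, hi, rfl⟩, ?_⟩
    have := h _ (hmem i hi) _ hi
    rw [heq i hi, edist_self, mul_zero] at this
    exact edist_le_zero.1 this
  have key := (measure_mono (μ := μH[(d : ℝ)]) hsub).trans
    (hLip.hausdorffMeasure_image_le d.cast_nonneg)
  simp only [Measure.euclideanHausdorffMeasure_def, Measure.smul_apply]
  rw [ENNReal.rpow_natCast] at key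
  simp only [Measure.nnreal_smul_coe_apply]
  calc _ ≤ _ := mul_le_mul_right key _
    _ = _ := mul_left_comm _ _ _

theorem volumeIoiPow_Ico (m : ℕ) {x y : Ioi (0 : ℝ)} (h : x ≤ y) :
    Measure.volumeIoiPow m (Ico x y) =
      ENNReal.ofReal ((y.1 ^ (m + 1) - x.1 ^ (m + 1)) / (m + 1)) := by
  have h1 : Ico x y = Iio y \ Iio x := by
    ext z; simp
  have hx : (0 : ℝ) < x.1 := x.2
  rw [h1, measure_sdiff (Iio_subset_Iio h) measurableSet_Iio.nullMeasurableSet,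
    Measure.volumeIoiPow_apply_Iio, Measure.volumeIoiPow_apply_Iio, ← ENNReal.ofReal_sub, sub_div]
  · positivity
  · rw [Measure.volumeIoiPow_apply_Iio]; exact ENNReal.ofReal_ne_top

variable {E : Type*} [NormedAddCommGroup E] [InnerProductSpace ℝ E]

/-- On a cap of the unit sphere of radius `ε` the orthogonal projection to the tangent space at its
pole distorts squared distances at most by the factor `1 - ε ^ 2`. -/
theorem norm_sub_sq_le_orthogonalProjection {v w w' : E} (hv : ‖v‖ = 1) (hw : ‖w‖ = 1)
    (hw' : ‖w'‖ = 1) {ε : ℝ} (h : dist w v ≤ ε) (h' : dist w' v ≤ ε) :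
    (1 - ε ^ 2) * ‖w - w'‖ ^ 2 ≤
      ‖(ℝ ∙ v)ᗮ.orthogonalProjectionOnto w - (ℝ ∙ v)ᗮ.orthogonalProjectionOnto w'‖ ^ 2 := by
  have hd := Submodule.norm_sq_eq_add_norm_sq_projection (w - w') (ℝ ∙ v)
  have hp : ‖(ℝ ∙ v).orthogonalProjectionOnto (w - w')‖ = |inner ℝ v (w - w')| := by
    change ‖((ℝ ∙ v).orthogonalProjectionOnto (w - w') : E)‖ = _
    rw [← Submodule.starProjection_apply, Submodule.starProjection_unit_singleton ℝ hv, norm_smul, hv, mul_one, Real.norm_eq_abs]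
  have ho : inner ℝ (w + w') (w - w') = 0 := by
    rw [real_inner_add_sub_eq_zero_iff, hw, hw']
  have hi : |inner ℝ v (w - w')| ≤ ε * ‖w - w'‖ := by
    -- Since `w + w'` is orthogonal to `w - w'`, half of it may be subtracted from `v`; what remains
    -- has norm at most `ε`.
    have h2 : inner ℝ v (w - w') = (1 / 2) * inner ℝ ((v - w) + (v - w')) (w - w') := by
      have : (v - w) + (v - w') = (2 : ℝ) • v - (w + w') := by rw [two_smul]; abel
      rw [this, inner_sub_left, ho, inner_smul_left]; simp
    rw [h2, abs_mul]
    have h3 := abs_real_inner_le_norm ((v - w) + (v - w')) (w - w')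
    have h4 : ‖(v - w) + (v - w')‖ ≤ 2 * ε := by
      refine (norm_add_le _ _).trans ?_
      rw [← dist_eq_norm, ← dist_eq_norm, dist_comm v, dist_comm v]; linarith
    have h5 := mul_le_mul_of_nonneg_right h4 (norm_nonneg (w - w'))
    rw [abs_of_pos (by norm_num : (0 : ℝ) < 1 / 2)]
    linarith
  rw [← map_sub]
  rw [hp, sq_abs] at hd
  have := pow_le_pow_left₀ (abs_nonneg _) hi 2
  rw [sq_abs, mul_pow] at this
  linarith

/-- Separates the radial from the angular displacement, so that a sector can be compared with a
cylinder. -/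
theorem norm_smul_sub_smul_sq {w w' : E} (hw : ‖w‖ = 1) (hw' : ‖w'‖ = 1) (s s' : ℝ) :
    ‖s • w - s' • w'‖ ^ 2 = (s - s') ^ 2 + s * s' * ‖w - w'‖ ^ 2 := by
  simp only [norm_sub_sq_real, norm_smul, mul_pow, inner_smul_left, inner_smul_right, hw, hw',
    Real.norm_eq_abs, sq_abs]
  simp; ring

variable [FiniteDimensional ℝ E] [MeasurableSpace E] [BorelSpace E]

/-- In polar coordinates the sector is a product, and its radial factor is the integral of `s ^ m`
over `[a, 1)`. -/
theorem volume_sector {m : ℕ} (hm : Module.finrank ℝ E = m + 1) {A : Set (sphere (0 : E) 1)}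
    (hA : MeasurableSet A) {a : ℝ} (ha : 0 < a) (ha1 : a < 1) :
    volume ((fun p : ℝ × sphere (0 : E) 1 => p.1 • (p.2 : E)) '' (Ico a 1 ×ˢ A)) =
      (volume : Measure E).toSphere A * ENNReal.ofReal ((1 - a ^ (m + 1)) / (m + 1)) := by
  have h := (Measure.measurePreserving_homeomorphUnitSphereProd
    (volume : Measure E)).measure_preimage
      (s := A ×ˢ Ico (⟨a, mem_Ioi.2 ha⟩ : Ioi (0 : ℝ)) ⟨1, mem_Ioi.2 one_pos⟩)
      (hA.prod measurableSet_Ico).nullMeasurableSet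
  rw [Measure.prod_prod, hm, Nat.add_sub_cancel, volumeIoiPow_Ico m (Subtype.mk_le_mk.2 ha1.le),
    comap_subtype_coe_apply (measurableSet_singleton _).compl] at h
  rw [one_pow] at h
  rw [← h]
  congr 1
  rw [← Homeomorph.image_symm, image_image]
  ext x
  constructor
  · rintro ⟨⟨s, w⟩, ⟨hs, hw⟩, rfl⟩
    exact ⟨(w, ⟨s, ha.trans_le hs.1⟩), ⟨hw, hs.1, hs.2⟩, rfl⟩
  · rintro ⟨⟨w, s⟩, ⟨hw, hs⟩, rfl⟩
    exact ⟨(s, w), ⟨⟨hs.1, hs.2⟩, hw⟩, rfl⟩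

/-- The integral of `s ^ m` over `[a, 1]` is at least `(1 - a) * a ^ m`; this is that bound
multiplied by `m + 1`. -/
theorem mul_pow_le_one_sub_pow (m : ℕ) {a : ℝ} (ha : 0 ≤ a) (ha1 : a ≤ 1) :
    (m + 1) * ((1 - a) * a ^ m) ≤ 1 - a ^ (m + 1) := by
  induction m with
  | zero => simp
  | succ k ih =>
    have h1 : 0 ≤ (1 - a) * a ^ k := mul_nonneg (by linarith) (pow_nonneg ha k)
    have h2 : (1 - a) * a ^ (k + 1) ≤ (1 - a) * a ^ k := by
      rw [pow_succ, ← mul_assoc]; exact mul_le_of_le_one_right h1 ha1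
    have h3 := mul_le_mul_of_nonneg_left h2 (by positivity : (0 : ℝ) ≤ (k : ℝ) + 1)
    have h4 : a ^ (k + 1 + 1) = a ^ (k + 1) * a := pow_succ _ _
    push_cast
    nlinarith

/-- Rests on `(1 - ε) ^ 2 ≤ 1 - ε ^ 2`. -/
theorem sq_le_of_mul_sq_le {ε x y : ℝ} (hε : 0 ≤ ε) (hε1 : ε < 1)
    (hy : 0 ≤ y) (h : (1 - ε ^ 2) * x ^ 2 ≤ y ^ 2) : x ≤ (1 - ε)⁻¹ * y := by
  rw [← div_eq_inv_mul, le_div_iff₀ (by linarith)]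
  refine le_of_sq_le_sq ?_ hy
  nlinarith [sq_nonneg x, mul_nonneg (mul_nonneg hε (by linarith : 0 ≤ 1 - ε)) (sq_nonneg x)]

/-- On small caps, the surface measure and the Hausdorff measure of the sphere are comparable with
constant close to one. -/
theorem toSphere_hausdorff_comparable {m : ℕ} (hm : Module.finrank ℝ E = m + 1)
    {ε : ℝ} (hε : 0 < ε) (hε1 : ε < 1) (v : sphere (0 : E) 1) {A : Set (sphere (0 : E) 1)}
    (hA : MeasurableSet A) (hAv : A ⊆ ball v ε) :
    (volume : Measure E).toSphere A ≤ ENNReal.ofReal ((1 - ε)⁻¹ ^ (2 * m + 1)) * μHE[m] A ∧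
    μHE[m] A ≤ ENNReal.ofReal ((1 - ε)⁻¹ ^ (2 * m + 1)) * (volume : Measure E).toSphere A := by
  have hv : ‖(v : E)‖ = 1 := by simp
  have hw : ∀ w : sphere (0 : E) 1, ‖(w : E)‖ = 1 := fun w => by simp
  set P : sphere (0 : E) 1 → (ℝ ∙ (v : E))ᗮ := fun w =>
    (ℝ ∙ (v : E))ᗮ.orthogonalProjectionOnto (w : E) with hP
  have hfr : Module.finrank ℝ (ℝ ∙ (v : E))ᗮ = m := by
    have : Fact (Module.finrank ℝ E = m + 1) := ⟨hm⟩
    exact Submodule.finrank_orthogonal_span_singleton (by rw [← norm_ne_zero_iff, hv]; simp)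
  set q : ℝ≥0 := ⟨(1 - ε)⁻¹, inv_nonneg.2 (by linarith)⟩ with hq
  have h1e : 0 < 1 - ε := by linarith
  have P_le : ∀ w w', ‖P w - P w'‖ ≤ ‖(w : E) - w'‖ := fun w w' => by
    rw [hP]; simp only [← map_sub]
    exact Submodule.norm_orthogonalProjectionOnto_apply_le _ _
  have le_P : ∀ w ∈ A, ∀ w' ∈ A, (1 - ε ^ 2) * ‖(w : E) - w'‖ ^ 2 ≤ ‖P w - P w'‖ ^ 2 :=
    fun w hwA w' hwA' => norm_sub_sq_le_orthogonalProjection hv (hw w) (hw w')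
      (hAv hwA).le (hAv hwA').le
  have hvolP : volume (P '' A) = μHE[m] (P '' A) := by
    rw [← InnerProductSpace.euclideanHausdorffMeasure_eq_volume, hfr]
  have b1 : volume (P '' A) ≤ μHE[m] A := by
    rw [hvolP]
    have := euclideanHausdorffMeasure_image_le_of_edist_le (f := P)
      (g := (id : sphere (0 : E) 1 → _)) (S := A) (K := 1) (fun w _ w' _ => by
        rw [edist_dist, edist_dist, ENNReal.coe_one, one_mul]
        apply ENNReal.ofReal_le_ofReal
        rw [dist_eq_norm, id, id, Subtype.dist_eq, dist_eq_norm]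
        exact P_le w w') m
    simpa using this
  have b2 : μHE[m] A ≤ (q : ℝ≥0∞) ^ m * volume (P '' A) := by
    rw [hvolP]
    have := euclideanHausdorffMeasure_image_le_of_edist_le (g := P)
      (f := (id : sphere (0 : E) 1 → _)) (S := A) (K := q) (fun w hw w' hw' => by
        rw [edist_dist, edist_dist, ← ENNReal.ofReal_coe_nnreal, ← ENNReal.ofReal_mul (NNReal.coe_nonneg q)]
        apply ENNReal.ofReal_le_ofReal
        rw [dist_eq_norm, id, id, Subtype.dist_eq, dist_eq_norm]
        exact sq_le_of_mul_sq_le hε.le hε1 (norm_nonneg _) (le_P w hw w' hw')) m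
    simpa using this
  -- `F` parametrises the sector over `A` and `G` the cylinder over its projection. Their distances
  -- agree up to the factor `(1 - ε)⁻¹`, so their volumes agree up to its power `m + 1`. The `L²`
  -- product makes the cylinder's volume both a product and a Hausdorff measure.
  set S : Set (ℝ × sphere (0 : E) 1) := Ico (1 - ε) 1 ×ˢ A with hS
  set F : ℝ × sphere (0 : E) 1 → E := fun p => p.1 • (p.2 : E) with hF
  set G : ℝ × sphere (0 : E) 1 → WithLp 2 (ℝ × (ℝ ∙ (v : E))ᗮ) :=
    fun p => WithLp.toLp 2 (p.1, P p.2) with hG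
  have hfrW : Module.finrank ℝ (WithLp 2 (ℝ × (ℝ ∙ (v : E))ᗮ)) = m + 1 := by
    rw [(WithLp.linearEquiv 2 ℝ (ℝ × (ℝ ∙ (v : E))ᗮ)).finrank_eq, Module.finrank_prod, hfr]
    simp [add_comm]
  have hnF : ∀ p p', ‖F p - F p'‖ ^ 2 =
      (p.1 - p'.1) ^ 2 + p.1 * p'.1 * ‖(p.2 : E) - p'.2‖ ^ 2 := fun p p' =>
    norm_smul_sub_smul_sq (hw _) (hw _) _ _
  have hnG : ∀ p p', ‖G p - G p'‖ ^ 2 = (p.1 - p'.1) ^ 2 + ‖P p.2 - P p'.2‖ ^ 2 := fun p p' => by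
    rw [WithLp.prod_norm_sq_eq_of_L2]
    simp [hG]
  have hvolF : volume (F '' S) = μHE[m + 1] (F '' S) := by
    rw [← InnerProductSpace.euclideanHausdorffMeasure_eq_volume, hm]
  have hvolG : volume (G '' S) = μHE[m + 1] (G '' S) := by
    rw [← InnerProductSpace.euclideanHausdorffMeasure_eq_volume, hfrW]
  have hGS : volume (G '' S) = ENNReal.ofReal ε * volume (P '' A) := by
    have h1 : G '' S = WithLp.ofLp ⁻¹' (Ico (1 - ε) 1 ×ˢ (P '' A)) := by
      ext y
      constructor
      · rintro ⟨⟨s, w⟩, ⟨hs, hw⟩, rfl⟩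
        exact ⟨hs, w, hw, rfl⟩
      · rintro ⟨hs, w, hw, h⟩
        refine ⟨(y.fst, w), ⟨hs, hw⟩, ?_⟩
        simp only [hG]
        rw [h]
        rfl
    rw [h1]
    have := (WithLp.volume_preserving_symm_measurableEquiv_toLp_prod ℝ
      (ℝ ∙ (v : E))ᗮ).measure_preimage_equiv (Ico (1 - ε) 1 ×ˢ (P '' A))
    refine this.trans ?_
    rw [Measure.volume_eq_prod, Measure.prod_prod, Real.volume_Ico, sub_sub_cancel]
  have hFS := volume_sector hm hA h1e (by linarith)
  have c1 : volume (F '' S) ≤ (q : ℝ≥0∞) ^ (m + 1) * volume (G '' S) := by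
    rw [hvolF, hvolG]
    refine euclideanHausdorffMeasure_image_le_of_edist_le (fun p hp p' hp' => ?_) (m + 1)
    rw [edist_dist, edist_dist, ← ENNReal.ofReal_coe_nnreal, ← ENNReal.ofReal_mul (NNReal.coe_nonneg q)]
    apply ENNReal.ofReal_le_ofReal
    rw [dist_eq_norm, dist_eq_norm]
    refine sq_le_of_mul_sq_le hε.le hε1 (norm_nonneg _) ?_
    rw [hnF, hnG]
    have h1 := le_P _ hp.2 _ hp'.2
    have h2 : p.1 * p'.1 ≤ 1 := mul_le_one₀ hp.1.2.le (h1e.le.trans hp'.1.1) hp'.1.2.le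
    have h3 := mul_le_mul_of_nonneg_right h2
      (mul_nonneg (by nlinarith : 0 ≤ 1 - ε ^ 2) (sq_nonneg ‖(p.2 : E) - p'.2‖))
    nlinarith [mul_nonneg (sq_nonneg ε) (sq_nonneg (p.1 - p'.1))]
  have c2 : volume (G '' S) ≤ (q : ℝ≥0∞) ^ (m + 1) * volume (F '' S) := by
    rw [hvolF, hvolG]
    refine euclideanHausdorffMeasure_image_le_of_edist_le (fun p hp p' hp' => ?_) (m + 1)
    rw [edist_dist, edist_dist, ← ENNReal.ofReal_coe_nnreal, ← ENNReal.ofReal_mul (NNReal.coe_nonneg q)]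
    apply ENNReal.ofReal_le_ofReal
    rw [dist_eq_norm, dist_eq_norm]
    change _ ≤ (1 - ε)⁻¹ * _
    rw [← div_eq_inv_mul, le_div_iff₀ h1e]
    refine le_of_sq_le_sq ?_ (norm_nonneg _)
    rw [mul_pow, hnF, hnG]
    have h1 := pow_le_pow_left₀ (norm_nonneg _) (P_le p.2 p'.2) 2
    have h2 : (1 - ε) * (1 - ε) ≤ p.1 * p'.1 :=
      mul_le_mul hp.1.1 hp'.1.1 h1e.le (h1e.le.trans hp.1.1)
    have h3 := mul_le_mul_of_nonneg_right h2 (sq_nonneg ‖(p.2 : E) - p'.2‖)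
    have h4 := mul_le_mul_of_nonneg_right h1 (sq_nonneg (1 - ε))
    have h5 : (1 - ε) ^ 2 ≤ 1 := by nlinarith
    nlinarith [mul_le_mul_of_nonneg_right h5 (sq_nonneg (p.1 - p'.1))]
  have hqr : ∀ k : ℕ, (q : ℝ≥0∞) ^ k = ENNReal.ofReal ((1 - ε)⁻¹ ^ k) := fun k => by
    rw [ENNReal.ofReal_pow (inv_nonneg.2 h1e.le)]
    congr 1
    rw [← ENNReal.ofReal_coe_nnreal]; rfl
  rw [hqr] at b2 c1 c2
  have hF' : volume (F '' S) = (volume : Measure E).toSphere A *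
    ENNReal.ofReal ((1 - (1 - ε) ^ (m + 1)) / (m + 1)) := hFS
  rw [hF', hGS] at c1 c2
  -- The exponent `2 * m + 1` is `m + 1` from comparing sector and cylinder plus `m` from the radial
  -- factor (first bound) or from the projection (second bound).
  have hm0 : (0 : ℝ) < (m : ℝ) + 1 := by positivity
  have t1 : ε * (1 - ε) ^ m ≤ (1 - (1 - ε) ^ (m + 1)) / (m + 1) := by
    rw [le_div_iff₀ hm0]
    have := mul_pow_le_one_sub_pow m h1e.le (by linarith)
    rw [sub_sub_cancel] at this
    linarith
  have t2 : (1 - (1 - ε) ^ (m + 1)) / (m + 1) ≤ ε := by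
    rw [div_le_iff₀ hm0]
    have := one_add_mul_le_pow (a := -ε) (by linarith) (m + 1)
    push_cast at this
    rw [← sub_eq_add_neg] at this
    linarith
  constructor
  · calc (volume : Measure E).toSphere A
        = (volume : Measure E).toSphere A * ENNReal.ofReal (ε * (1 - ε) ^ m) *
          ENNReal.ofReal (ε⁻¹ * (1 - ε)⁻¹ ^ m) := by
          rw [mul_assoc, ← ENNReal.ofReal_mul (by positivity)]
          have : ε * (1 - ε) ^ m * (ε⁻¹ * (1 - ε)⁻¹ ^ m) = 1 := by
            rw [inv_pow]; field_simp
          rw [this]; simp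
      _ ≤ (volume : Measure E).toSphere A *
          ENNReal.ofReal ((1 - (1 - ε) ^ (m + 1)) / (m + 1)) *
          ENNReal.ofReal (ε⁻¹ * (1 - ε)⁻¹ ^ m) := by gcongr
      _ ≤ ENNReal.ofReal ((1 - ε)⁻¹ ^ (m + 1)) * (ENNReal.ofReal ε * μHE[m] A) *
          ENNReal.ofReal (ε⁻¹ * (1 - ε)⁻¹ ^ m) := by
          exact mul_le_mul_left (c1.trans (mul_le_mul_right (mul_le_mul_right b1 _) _)) _
      _ = ENNReal.ofReal ((1 - ε)⁻¹ ^ (m + 1) * ε * (ε⁻¹ * (1 - ε)⁻¹ ^ m)) * μHE[m] A := by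
          rw [ENNReal.ofReal_mul (p := (1 - ε)⁻¹ ^ (m + 1) * ε) (by positivity),
            ENNReal.ofReal_mul (p := (1 - ε)⁻¹ ^ (m + 1)) (by positivity)]
          ring
      _ = _ := by
          congr 2
          field_simp
          ring
  · calc μHE[m] A ≤ ENNReal.ofReal ((1 - ε)⁻¹ ^ m) * volume (P '' A) := b2
      _ = ENNReal.ofReal ((1 - ε)⁻¹ ^ m) *
          (ENNReal.ofReal ε⁻¹ * (ENNReal.ofReal ε * volume (P '' A))) := by
          rw [← mul_assoc (ENNReal.ofReal ε⁻¹), ← ENNReal.ofReal_mul (by positivity),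
            inv_mul_cancel₀ hε.ne']
          simp
      _ ≤ ENNReal.ofReal ((1 - ε)⁻¹ ^ m) * (ENNReal.ofReal ε⁻¹ *
          (ENNReal.ofReal ((1 - ε)⁻¹ ^ (m + 1)) *
            ((volume : Measure E).toSphere A * ENNReal.ofReal ε))) := by
          exact mul_le_mul_right (mul_le_mul_right (c2.trans (by gcongr)) _) _
      _ = ENNReal.ofReal ((1 - ε)⁻¹ ^ m * (ε⁻¹ * ((1 - ε)⁻¹ ^ (m + 1) * ε))) *
          (volume : Measure E).toSphere A := by
          rw [ENNReal.ofReal_mul (by positivity), ENNReal.ofReal_mul (by positivity),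
            ENNReal.ofReal_mul (by positivity)]
          ring
      _ = _ := by
          congr 2
          field_simp
          ring

/-- Countably many balls of radius `ε` cover the space; made disjoint, they cut `A` into pieces
whose estimates add up. -/
theorem measure_le_smul_of_forall_ball {X : Type*} [PseudoMetricSpace X] [MeasurableSpace X]
    [BorelSpace X] [SecondCountableTopology X] {μ ν : Measure X} {c : ℝ≥0∞} {ε : ℝ} (hε : 0 < ε)
    (h : ∀ v, ∀ A ⊆ ball v ε, MeasurableSet A → μ A ≤ c * ν A) {A : Set X}
    (hA : MeasurableSet A) : μ A ≤ c * ν A := by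
  rcases isEmpty_or_nonempty X with hX | hX
  · simp [A.eq_empty_of_isEmpty]
  have hcov : ⋃ k, ball (TopologicalSpace.denseSeq X k) ε = univ := by
    refine eq_univ_of_forall fun x => mem_iUnion.2 ?_
    obtain ⟨_, ⟨k, rfl⟩, hk⟩ := Metric.dense_iff.1
      (TopologicalSpace.denseRange_denseSeq X) x ε hε |>.imp fun _ => And.symm
    exact ⟨k, by rwa [mem_ball, dist_comm, ← mem_ball]⟩
  set B := disjointed fun k => ball (TopologicalSpace.denseSeq X k) ε with hB
  have hBm : ∀ k, MeasurableSet (B k) := MeasurableSet.disjointed fun k => measurableSet_ball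
  have hBu : A = ⋃ k, A ∩ B k := by
    rw [← inter_iUnion, hB, iUnion_disjointed, hcov, inter_univ]
  have hBd : Pairwise (Function.onFun Disjoint fun k => A ∩ B k) := fun i j hij =>
    (disjoint_disjointed _ hij).mono inter_subset_right inter_subset_right
  rw [hBu, measure_iUnion hBd fun k => hA.inter (hBm k),
    measure_iUnion hBd fun k => hA.inter (hBm k), ← ENNReal.tsum_mul_left]
  exact ENNReal.tsum_le_tsum fun k => h _ _ (inter_subset_right.trans (disjointed_subset _ _))
    (hA.inter (hBm k))

/-- The surface measure of the unit sphere is its Euclidean Hausdorff measure. -/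
theorem toSphere_eq_euclideanHausdorffMeasure {m : ℕ} (hm : Module.finrank ℝ E = m + 1) :
    (volume : Measure E).toSphere = μHE[m] := by
  have hlim : ∀ c : ℝ≥0∞, Tendsto (fun ε : ℝ => ENNReal.ofReal ((1 - ε)⁻¹ ^ (2 * m + 1)) * c)
      (𝓝[>] 0) (𝓝 c) := fun c => by
    have h1 : Tendsto (fun ε : ℝ => (1 - ε)⁻¹ ^ (2 * m + 1)) (𝓝[>] 0) (𝓝 1) := by
      have : ContinuousAt (fun ε : ℝ => (1 - ε)⁻¹ ^ (2 * m + 1)) 0 := by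
        fun_prop (disch := norm_num)
      have := this.tendsto
      simp only [sub_zero, inv_one, one_pow] at this
      exact this.mono_left nhdsWithin_le_nhds
    have h2 := ENNReal.Tendsto.mul_const (b := c) (ENNReal.tendsto_ofReal h1) (by simp)
    simpa using h2
  have hmem : Ioo (0 : ℝ) 1 ∈ 𝓝[>] (0 : ℝ) := Ioo_mem_nhdsGT one_pos
  refine Measure.ext fun A hA => le_antisymm ?_ ?_
  · refine ge_of_tendsto (hlim _) ?_
    filter_upwards [hmem] with ε hε
    exact measure_le_smul_of_forall_ball hε.1 (fun v B hB hBm =>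
      (toSphere_hausdorff_comparable hm hε.1 hε.2 v hBm hB).1) hA
  · refine ge_of_tendsto (hlim _) ?_
    filter_upwards [hmem] with ε hε
    exact measure_le_smul_of_forall_ball hε.1 (fun v B hB hBm =>
      (toSphere_hausdorff_comparable hm hε.1 hε.2 v hBm hB).2) hA

/-- Integration over a sphere against the Hausdorff measure, in terms of the unit sphere. -/
theorem map_toSphere_eq_restrict_sphere {m : ℕ} (hm : Module.finrank ℝ E = m + 1) (x₀ : E) {r : ℝ}
    (hr : 0 < r) :
    μHE[m].restrict (sphere x₀ r) = ENNReal.ofReal (r ^ m) •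
      (volume : Measure E).toSphere.map (fun w : sphere (0 : E) 1 => x₀ + r • (w : E)) := by
  have hmeas : Measurable fun w : sphere (0 : E) 1 => x₀ + r • (w : E) := by fun_prop
  rw [toSphere_eq_euclideanHausdorffMeasure hm]
  refine Measure.ext fun A hA => ?_
  rw [Measure.restrict_apply hA, Measure.smul_apply, Measure.map_apply hmeas hA,
    ← (isometry_subtype_coe (s := sphere (0 : E) 1)).euclideanHausdorffMeasure_image]
  -- Only the homothety is not an isometry; it produces the factor `r ^ m`.
  have h1 : A ∩ sphere x₀ r = AffineMap.homothety x₀ r '' ((fun y => x₀ + y) ''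
      ((↑) '' ((fun w : sphere (0 : E) 1 => x₀ + r • (w : E)) ⁻¹' A))) := by
    rw [image_image, image_image]
    ext y
    simp only [AffineMap.homothety_apply, vsub_eq_sub, vadd_eq_add, add_sub_cancel_left, mem_image,
      mem_preimage, mem_inter_iff, mem_sphere_iff_norm]
    constructor
    · rintro ⟨hy, hn⟩
      have hc : x₀ + r • (r⁻¹ • (y - x₀)) = y := by rw [smul_inv_smul₀ hr.ne']; abel
      refine ⟨⟨r⁻¹ • (y - x₀), ?_⟩, ?_, ?_⟩
      · rw [mem_sphere_zero_iff_norm, norm_smul, hn, norm_inv, Real.norm_of_nonneg hr.le,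
          inv_mul_cancel₀ hr.ne']
      · simpa only [hc] using hy
      · rw [add_comm]; exact hc
    · rintro ⟨w, hw, rfl⟩
      refine ⟨by rwa [add_comm], ?_⟩
      rw [add_sub_cancel_right, norm_smul, Real.norm_of_nonneg hr.le]
      simp
  rw [h1, euclideanHausdorffMeasure_homothety_image _ _ hr.ne',
    (isometry_add_left x₀).euclideanHausdorffMeasure_image]
  rw [ENNReal.smul_def]
  congr 1
  rw [← ENNReal.ofReal_coe_nnreal]
  simp [abs_of_pos hr]

end SphereMeasure

/-! ### Divergence theorem on a ball for Lipschitz functions -/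

section BallDivergence

variable {E : Type*} [NormedAddCommGroup E] [InnerProductSpace ℝ E]

theorem hasLineDerivAt_norm_sub_rpow {x y : E} (h : y ≠ x) (q : ℝ) (e : E) :
    HasLineDerivAt ℝ (fun y => ‖y - x‖ ^ q) (q * ‖y - x‖ ^ (q - 2) * inner ℝ (y - x) e) y e := by
  have h0 : 0 < ‖y - x‖ := norm_pos_iff.2 (sub_ne_zero.2 h)
  have h1 : HasFDerivAt (fun y : E => ‖y - x‖ ^ 2) (2 • (innerSL ℝ (y - x)).comp
      (ContinuousLinearMap.id ℝ E)) y := ((hasFDerivAt_id y).sub_const x).norm_sq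
  have h2 := h1.rpow_const (p := q / 2) (Or.inl (by positivity))
  have h3 : (fun y : E => (‖y - x‖ ^ 2) ^ (q / 2)) = fun y => ‖y - x‖ ^ q := by
    ext z
    rw [← Real.rpow_natCast, ← Real.rpow_mul (norm_nonneg _)]
    congr 1; push_cast; ring
  rw [h3] at h2
  have h4 := h2.hasLineDerivAt e
  convert! h4 using 1
  have h5 : (‖y - x‖ ^ 2) ^ (q / 2 - 1) = ‖y - x‖ ^ (q - 2) := by
    rw [← Real.rpow_natCast, ← Real.rpow_mul (norm_nonneg _)]
    congr 1; push_cast; ring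
  rw [h5]
  change _ = q / 2 * _ * (2 • inner ℝ (y - x) e)
  rw [nsmul_eq_mul]
  push_cast
  ring

/-- Truncation at distance `d` makes the singular potential globally Lipschitz without changing it
where `‖y - x‖ ≥ d`. -/
theorem lipschitzWith_max_norm_sub_rpow {F : Type*} [NormedAddCommGroup F] (x : F) {p d : ℝ} (hp : 0 ≤ p) (hd : 0 < d) :
    ∃ C, LipschitzWith C fun y : F => (max ‖y - x‖ d) ^ (-p) := by
  have h1 : LipschitzOnWith (p * d ^ (-p - 1)).toNNReal (fun t : ℝ => t ^ (-p)) (Ici d) := by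
    refine Convex.lipschitzOnWith_of_nnnorm_deriv_le (𝕜 := ℝ) (fun t ht => ?_) (fun t ht => ?_)
      (convex_Ici d)
    · exact (Real.hasDerivAt_rpow_const (Or.inl (hd.trans_le ht).ne')).differentiableAt
    · have ht0 : 0 < t := hd.trans_le ht
      rw [(Real.hasDerivAt_rpow_const (Or.inl ht0.ne')).deriv, ← NNReal.coe_le_coe, coe_nnnorm,
        norm_mul, norm_neg, Real.norm_of_nonneg hp, Real.norm_of_nonneg (by positivity)]
      refine le_trans ?_ (Real.le_coe_toNNReal _)
      exact mul_le_mul_of_nonneg_left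
        (Real.rpow_le_rpow_of_nonpos hd ht (by linarith)) hp
  have h2 : LipschitzWith 1 fun y : F => max ‖y - x‖ d := by
    refine LipschitzWith.max_const (LipschitzWith.of_dist_le_mul fun y z => ?_) d
    rw [NNReal.coe_one, one_mul, Real.dist_eq, dist_eq_norm]
    simpa using abs_norm_sub_norm_le (y - x) (z - x)
  refine ⟨_, lipschitzOnWith_univ.1 (h1.comp h2.lipschitzOnWith fun y _ =>
    mem_Ici.2 (le_max_right _ _))⟩

/-- The tent has gradient `-x / |x|` inside the ball and zero outside, so integrating against it
produces the radial normal. -/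
theorem lineDeriv_tent {r : ℝ} {x : E} (hx0 : x ≠ 0) (hx : ‖x‖ ≠ r) (e : E) :
    lineDeriv ℝ (fun x : E => max 0 (r - ‖x‖)) x e =
      (ball (0 : E) r).indicator (fun x => -(‖x‖⁻¹ * inner ℝ x e)) x := by
  rcases lt_or_gt_of_ne hx with h | h
  · rw [indicator_of_mem (by simpa using h)]
    have h1 : (fun x : E => max 0 (r - ‖x‖)) =ᶠ[𝓝 x] fun x => r - ‖x - 0‖ ^ (1 : ℝ) := by
      have : ∀ᶠ y in 𝓝 x, ‖y‖ < r := continuous_norm.continuousAt.eventually_lt_const h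
      filter_upwards [this] with y hy
      rw [Real.rpow_one, sub_zero, max_eq_right (by linarith)]
    rw [h1.lineDeriv_eq]
    have h2 := hasLineDerivAt_norm_sub_rpow hx0 1 e
    have h3 : HasLineDerivAt ℝ (fun x : E => r - ‖x - 0‖ ^ (1 : ℝ))
      (-(1 * ‖x - 0‖ ^ ((1 : ℝ) - 2) * inner ℝ (x - 0) e)) x e := HasDerivAt.const_sub r h2
    rw [h3.lineDeriv]
    norm_num [Real.rpow_neg_one]
  · rw [indicator_of_notMem (by simpa using h.le)]
    have h1 : (fun x : E => max 0 (r - ‖x‖)) =ᶠ[𝓝 x] fun x => 0 := by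
      have : ∀ᶠ y in 𝓝 x, r < ‖y‖ := continuous_norm.continuousAt.eventually_const_lt h
      filter_upwards [this] with y hy
      exact max_eq_left (by linarith)
    rw [h1.lineDeriv_eq]
    exact (hasDerivAt_const (0 : ℝ) (0 : ℝ)).deriv

theorem lipschitzWith_tent {F : Type*} [NormedAddCommGroup F] (r : ℝ) :
    LipschitzWith 1 fun x : F => max 0 (r - ‖x‖) := by
  refine LipschitzWith.const_max (LipschitzWith.of_dist_le_mul fun y z => ?_) 0
  rw [NNReal.coe_one, one_mul, Real.dist_eq, dist_eq_norm, sub_sub_sub_cancel_left, abs_sub_comm]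
  exact abs_norm_sub_norm_le y z

theorem hasCompactSupport_tent [FiniteDimensional ℝ E] (r : ℝ) : HasCompactSupport fun x : E => max 0 (r - ‖x‖) := by
  refine HasCompactSupport.intro (isCompact_closedBall 0 r) fun x hx => ?_
  rw [mem_closedBall_zero_iff, not_le] at hx
  exact max_eq_left (by linarith)

variable [FiniteDimensional ℝ E] [MeasurableSpace E] [BorelSpace E]

/-- Integration in polar coordinates. -/
theorem integral_polar {m : ℕ} (hm : Module.finrank ℝ E = m + 1) {f : E → ℝ} (hf : Integrable f) :
    ∫ x, f x = ∫ s in Ioi (0 : ℝ), s ^ m *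
      ∫ w : sphere (0 : E) 1, f (s • (w : E)) ∂(volume : Measure E).toSphere := by
  have : Nontrivial E := Module.nontrivial_of_finrank_pos (R := ℝ) (by omega)
  have hmp := Measure.measurePreserving_homeomorphUnitSphereProd (volume : Measure E)
  set F : sphere (0 : E) 1 × Ioi (0 : ℝ) → ℝ := fun z => f (z.2.1 • (z.1 : E)) with hF
  have hFc : F ∘ homeomorphUnitSphereProd E = fun x : ({0}ᶜ : Set E) => f x := by
    ext x
    have : (x : E) ≠ 0 := x.2
    simp only [hF, Function.comp_apply, homeomorphUnitSphereProd_apply_snd_coe,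
      homeomorphUnitSphereProd_apply_fst_coe]
    rw [smul_inv_smul₀ (norm_ne_zero_iff.2 this)]
  have hint : Integrable F ((volume : Measure E).toSphere.prod
      (Measure.volumeIoiPow (Module.finrank ℝ E - 1))) := by
    rw [← hmp.integrable_comp_emb (Homeomorph.measurableEmbedding _), hFc]
    have := (integrableOn_iff_comap_subtypeVal (μ := (volume : Measure E)) (f := f)
      (measurableSet_singleton (0 : E)).compl).1 hf.integrableOn
    exact this
  calc ∫ x, f x = ∫ x : ({(0)}ᶜ : Set E), f x ∂((volume : Measure E).comap (↑)) := by
        rw [integral_subtype_comap (measurableSet_singleton _).compl f, restrict_compl_singleton]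
    _ = ∫ z, F z ∂((volume : Measure E).toSphere.prod
          (Measure.volumeIoiPow (Module.finrank ℝ E - 1))) := by
        rw [← hmp.integral_comp (Homeomorph.measurableEmbedding _), ← hFc]
        rfl
    _ = ∫ s : Ioi (0 : ℝ), ∫ w, f (s.1 • (w : E)) ∂(volume : Measure E).toSphere
          ∂(Measure.volumeIoiPow (Module.finrank ℝ E - 1)) := integral_prod_symm F hint
    _ = _ := by
        simp only [Measure.volumeIoiPow, ENNReal.ofReal]
        rw [integral_withDensity_eq_integral_smul,
          integral_subtype_comap measurableSet_Ioi fun a : ℝ =>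
            Real.toNNReal (a ^ (Module.finrank ℝ E - 1)) •
              ∫ w : sphere (0 : E) 1, f (a • (w : E)) ∂(volume : Measure E).toSphere,
          setIntegral_congr_fun measurableSet_Ioi fun s hs => ?_]
        · rw [NNReal.smul_def, Real.coe_toNNReal _ (pow_nonneg (le_of_lt hs) _), smul_eq_mul, hm,
            Nat.add_sub_cancel]
        · exact (measurable_subtype_coe.pow_const _).real_toNNReal

/-- The divergence theorem integrated over the radius: integrate by parts onto the tent, then pass
to polar coordinates. -/
theorem integral_lineDeriv_mul_tent {m : ℕ} (hm : Module.finrank ℝ E = m + 1) {g : E → ℝ} {C : ℝ≥0}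
    (hg : LipschitzWith C g) (e : E) {r : ℝ} (hr : 0 ≤ r) :
    ∫ x, lineDeriv ℝ g x e * max 0 (r - ‖x‖) = ∫ s in (0 : ℝ)..r, s ^ m *
      ∫ w : sphere (0 : E) 1, g (s • (w : E)) * inner ℝ (w : E) e
        ∂(volume : Measure E).toSphere := by
  have : Nontrivial E := Module.nontrivial_of_finrank_pos (R := ℝ) (by omega)
  rw [hg.integral_lineDeriv_mul_eq (lipschitzWith_tent r) (hasCompactSupport_tent r)]
  set f : E → ℝ := (ball (0 : E) r).indicator fun x => g x * (‖x‖⁻¹ * inner ℝ x e) with hf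
  have h1 : ∀ᵐ x : E, lineDeriv ℝ (fun x : E => max 0 (r - ‖x‖)) x (-e) * g x = f x := by
    have a1 : ∀ᵐ x : E, x ≠ 0 := by simp [ae_iff]
    have a2 : ∀ᵐ x : E, ‖x‖ ≠ r := by
      have : volume (sphere (0 : E) r) = 0 := Measure.addHaar_sphere _ _ _
      rw [ae_iff]
      convert! this using 2
      ext x; simp
    filter_upwards [a1, a2] with x hx0 hx
    rw [lineDeriv_tent hx0 hx, hf]
    by_cases h : x ∈ ball (0 : E) r
    · simp only [indicator_of_mem h, inner_neg_right]; ring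
    · simp only [indicator_of_notMem h]; ring
  rw [integral_congr_ae h1]
  have hfi : Integrable f := by
    rw [hf, integrable_indicator_iff measurableSet_ball]
    obtain ⟨M, hM⟩ := (isCompact_closedBall (0 : E) r).exists_bound_of_continuousOn
      hg.continuous.continuousOn
    refine Measure.integrableOn_of_bounded (M := M * ‖e‖) measure_ball_lt_top.ne ?_ ?_
    · have : Measurable g := hg.continuous.measurable
      exact Measurable.aestronglyMeasurable (by fun_prop)
    · filter_upwards [ae_restrict_mem measurableSet_ball] with x hx
      rw [norm_mul, norm_mul]
      have b1 := hM x (ball_subset_closedBall hx)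
      have b2 : ‖‖x‖⁻¹‖ * ‖inner ℝ x e‖ ≤ ‖e‖ := by
        rw [norm_inv, norm_norm]
        rcases eq_or_ne x 0 with rfl | hx0
        · simp
        · rw [inv_mul_le_iff₀ (norm_pos_iff.2 hx0)]
          exact norm_inner_le_norm x e
      exact mul_le_mul b1 b2 (by positivity) ((norm_nonneg _).trans b1)
  rw [integral_polar hm hfi, intervalIntegral.integral_of_le hr,
    integral_Ioc_eq_integral_Ioo]
  have hn : ∀ s : ℝ, 0 < s → ∀ w : sphere (0 : E) 1, ‖s • (w : E)‖ = s := fun s hs w => by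
    rw [norm_smul, Real.norm_of_nonneg hs.le]; simp
  rw [setIntegral_eq_of_subset_of_forall_sdiff_eq_zero measurableSet_Ioi
    (s := Ioo 0 r) Ioo_subset_Ioi_self]
  · refine setIntegral_congr_fun measurableSet_Ioo fun s hs => ?_
    congr 2
    ext w
    rw [hf, indicator_of_mem (by rw [mem_ball_zero_iff, hn s hs.1]; exact hs.2), hn s hs.1,
      inner_smul_left]
    simp [hs.1.ne']
  · intro s hs
    have hs0 : 0 < s := hs.1
    have hsr : r ≤ s := not_lt.1 fun h => hs.2 ⟨hs0, h⟩
    have : ∀ w : sphere (0 : E) 1, f (s • (w : E)) = 0 := fun w => by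
      rw [hf, indicator_of_notMem (by rw [mem_ball_zero_iff, hn s hs0]; exact hsr.not_gt)]
    simp [this]

/-- The divergence theorem on a ball, for a Lipschitz function. -/
theorem integral_ball_lineDeriv {m : ℕ} (hm : Module.finrank ℝ E = m + 1) {g : E → ℝ} {C : ℝ≥0}
    (hg : LipschitzWith C g) (e : E) {r : ℝ} (hr : 0 < r) :
    ∫ x in ball (0 : E) r, lineDeriv ℝ g x e = r ^ m *
      ∫ w : sphere (0 : E) 1, g (r • (w : E)) * inner ℝ (w : E) e
        ∂(volume : Measure E).toSphere := by
  have : Nontrivial E := Module.nontrivial_of_finrank_pos (R := ℝ) (by omega)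
  -- `integral_lineDeriv_mul_tent` is now differentiated in the radius at `r`: the right side by the
  -- fundamental theorem of calculus, the left side under the integral, where the tent has
  -- radial-parameter derivative equal to the indicator of the ball, off the null sphere.
  have hcont : Continuous fun s : ℝ => s ^ m *
      ∫ w : sphere (0 : E) 1, g (s • (w : E)) * inner ℝ (w : E) e
        ∂(volume : Measure E).toSphere := by
    refine (continuous_pow m).mul ?_
    have hc : Continuous (Function.uncurry fun (s : ℝ) (w : sphere (0 : E) 1) =>
        g (s • (w : E)) * inner ℝ (w : E) e) := by
      have := hg.continuous
      unfold Function.uncurry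
      fun_prop
    have := continuous_parametric_integral_of_continuous
      (μ := (volume : Measure E).toSphere) hc isCompact_univ
    simpa using this
  have hR := (hcont.integral_hasStrictDerivAt 0 r).hasDerivAt
  have hmeas : AEStronglyMeasurable (fun x => lineDeriv ℝ g x e) volume :=
    (measurable_lineDeriv hg.continuous).aestronglyMeasurable
  have hb : ∀ x, |lineDeriv ℝ g x e| ≤ C * ‖e‖ := fun x => norm_lineDeriv_le_of_lipschitz ℝ hg
  have htent : ∀ (s : ℝ) (x : E), |max 0 (s - ‖x‖)| ≤ |s| := fun s x => by
    rw [abs_of_nonneg (le_max_left _ _)]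
    exact max_le (abs_nonneg s) (by linarith [le_abs_self s, norm_nonneg x])
  have hL := hasDerivAt_integral_of_dominated_loc_of_lip (𝕜 := ℝ) (μ := (volume : Measure E))
    (F := fun s x => lineDeriv ℝ g x e * max 0 (s - ‖x‖)) (x₀ := r) (s := ball r 1)
    (F' := (ball (0 : E) r).indicator fun x => lineDeriv ℝ g x e)
    (bound := (ball (0 : E) (r + 1)).indicator fun _ => C * ‖e‖)
    (ball_mem_nhds _ one_pos)
    (Eventually.of_forall fun s => hmeas.mul
      (lipschitzWith_tent s).continuous.aestronglyMeasurable)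
    (by
      have h1 : Integrable fun x : E => max 0 (r - ‖x‖) :=
        (lipschitzWith_tent r).continuous.integrable_of_hasCompactSupport
          (hasCompactSupport_tent r)
      exact h1.bdd_mul hmeas (Eventually.of_forall hb))
    (hmeas.indicator measurableSet_ball)
    (Eventually.of_forall fun x => by
      refine LipschitzOnWith.of_dist_le_mul fun s hs t ht => ?_
      rw [Real.coe_nnabs, Real.dist_eq, Real.dist_eq]
      by_cases hx : x ∈ ball (0 : E) (r + 1)
      · rw [indicator_of_mem hx, ← mul_sub, abs_mul, abs_of_nonneg (by positivity : 0 ≤ C * ‖e‖)]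
        refine mul_le_mul (hb x) ?_ (abs_nonneg _) (by positivity)
        have := abs_max_sub_max_le_abs (s - ‖x‖) (t - ‖x‖) 0
        rwa [max_comm, max_comm (t - ‖x‖), sub_sub_sub_cancel_right] at this
      · rw [mem_ball_zero_iff, not_lt] at hx
        rw [mem_ball, Real.dist_eq, abs_lt] at hs ht
        rw [max_eq_left (by linarith), max_eq_left (by linarith)]
        simp only [mul_zero, sub_self, abs_zero]
        positivity)
    ((integrable_indicator_iff measurableSet_ball).2
      (integrableOn_const measure_ball_lt_top.ne))
    (by
      have : volume (sphere (0 : E) r) = 0 := Measure.addHaar_sphere _ _ _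
      have h2 : ∀ᵐ x : E, ‖x‖ ≠ r := by
        rw [ae_iff]
        convert! this using 2
        ext x; simp
      filter_upwards [h2] with x hx
      rcases lt_or_gt_of_ne hx with h | h
      · rw [indicator_of_mem (by simpa using h)]
        have h3 : HasDerivAt (fun s => lineDeriv ℝ g x e * (s - ‖x‖)) (lineDeriv ℝ g x e) r := by
          simpa using ((hasDerivAt_id r).sub_const ‖x‖).const_mul (lineDeriv ℝ g x e)
        refine h3.congr_of_eventuallyEq ?_
        filter_upwards [lt_mem_nhds h] with s hs
        rw [max_eq_right (by linarith)]
      · rw [indicator_of_notMem (by simpa using h.le)]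
        refine (hasDerivAt_const r (0 : ℝ)).congr_of_eventuallyEq ?_
        filter_upwards [gt_mem_nhds h] with s hs
        rw [max_eq_left (by linarith), mul_zero])
  have hL' := hL.2.congr_of_eventuallyEq
    (f₁ := fun u => ∫ s in (0 : ℝ)..u, s ^ m *
      ∫ w : sphere (0 : E) 1, g (s • (w : E)) * inner ℝ (w : E) e
        ∂(volume : Measure E).toSphere) (by
      filter_upwards [lt_mem_nhds hr] with s hs
      exact (integral_lineDeriv_mul_tent hm hg e hs.le).symm)
  rw [← integral_indicator measurableSet_ball]
  exact hL'.unique hR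

end BallDivergence

/-! ### The fractional gradient of a ball as a surface integral -/

section FracGradBall

/-- For `|z| ≥ d` one has `1 + |z| ≤ (d⁻¹ + 1) |z|`, so `(1 + |z|)^(-q)` dominates up to a constant.
-/
theorem integrableOn_compl_ball_norm_rpow {E : Type*} [NormedAddCommGroup E] [NormedSpace ℝ E]
    [FiniteDimensional ℝ E] [MeasurableSpace E] [BorelSpace E] {μ : Measure E} [μ.IsAddHaarMeasure]
    {q d : ℝ} (hq : (Module.finrank ℝ E : ℝ) < q) (hd : 0 < d) :
    IntegrableOn (fun z : E => ‖z‖ ^ (-q)) (ball 0 d)ᶜ μ := by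
  have h := ((integrable_one_add_norm (μ := μ) hq).const_mul ((d⁻¹ + 1) ^ q)).integrableOn
    (s := (ball 0 d)ᶜ)
  refine h.mono' ?_ ?_
  · exact Measurable.aestronglyMeasurable (by fun_prop)
  · filter_upwards [ae_restrict_mem measurableSet_ball.compl] with z hz
    rw [mem_compl_iff, mem_ball_zero_iff, not_lt] at hz
    have hz0 : 0 < ‖z‖ := hd.trans_le hz
    have hq0 : 0 < q := (Nat.cast_nonneg _).trans_lt hq
    rw [Real.norm_of_nonneg (by positivity), Real.rpow_neg (by positivity),
      Real.rpow_neg (by positivity), ← div_eq_mul_inv, ← Real.div_rpow (by positivity)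
      (by positivity), ← Real.inv_rpow hz0.le]
    refine Real.rpow_le_rpow (by positivity) ?_ hq0.le
    rw [inv_eq_one_div, div_le_div_iff₀ hz0 (by positivity), one_mul]
    have : 1 ≤ d⁻¹ * ‖z‖ := by rw [← div_eq_inv_mul, le_div_iff₀ hd]; linarith
    linarith

theorem measurable_chi {n : ℕ} {A : Set (Rn n)} (hA : MeasurableSet A) : Measurable (chi A) :=
  measurable_const.indicator hA

theorem measurable_fracGradIntegrand {n : ℕ} (α : ℝ) {f : Rn n → ℝ} (hf : Measurable f)
    (x : Rn n) : Measurable (fracGradIntegrand α f x) := by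
  unfold fracGradIntegrand
  fun_prop

theorem norm_fracGradIntegrand {n : ℕ} (α : ℝ) (f : Rn n → ℝ) (x y : Rn n) :
    ‖fracGradIntegrand α f x y‖ = |f y - f x| * ‖y - x‖ ^ (-((n : ℝ) + α)) := by
  rcases eq_or_ne y x with rfl | h
  · simp [fracGradIntegrand]
  · have h0 : 0 < ‖y - x‖ := norm_pos_iff.2 (sub_ne_zero.2 h)
    rw [fracGradIntegrand, norm_smul, norm_div, Real.norm_eq_abs,
      Real.norm_of_nonneg (by positivity), Real.rpow_add_one h0.ne', Real.rpow_neg h0.le]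
    field_simp

/-- The bound is the gap between `x` and the sphere, which `y` is too close to `x` to cross. -/
theorem chi_ball_eq_of_dist_lt {n : ℕ} {x₀ x y : Rn n} {r : ℝ}
    (h : dist y x < |dist x x₀ - r|) : chi (ball x₀ r) y = chi (ball x₀ r) x := by
  have h1 := dist_triangle y x x₀
  have h2 := dist_triangle x y x₀
  rw [dist_comm x y] at h2
  unfold chi
  by_cases hx : dist x x₀ < r
  · rw [abs_of_neg (by linarith)] at h
    rw [indicator_of_mem (by rw [mem_ball]; linarith), indicator_of_mem (by rwa [mem_ball])]
  · rw [abs_of_nonneg (by linarith)] at h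
    rw [indicator_of_notMem (by rw [mem_ball]; linarith), indicator_of_notMem (by rwa [mem_ball])]

theorem abs_chi_sub_chi_le {n : ℕ} (A : Set (Rn n)) (x y : Rn n) : |chi A y - chi A x| ≤ 1 := by
  unfold chi
  by_cases hx : x ∈ A <;> by_cases hy : y ∈ A <;> simp [hx, hy]

/-- The integrand vanishes within the gap between `x` and the sphere, and beyond it is at most `|y -
x|^(-(n+α))`, integrable at infinity as `α > 0`. -/
theorem integrable_fracGradIntegrand_ball {n : ℕ} {α : ℝ} (hα : 0 < α) {x₀ x : Rn n} {r : ℝ}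
    (hx : x ∉ sphere x₀ r) : Integrable (fracGradIntegrand α (chi (ball x₀ r)) x) := by
  have hd : 0 < |dist x x₀ - r| := abs_pos.2 (sub_ne_zero.2 hx)
  have h1 := (integrable_indicator_iff measurableSet_ball.compl).2
    (integrableOn_compl_ball_norm_rpow (E := Rn n) (μ := volume) (q := n + α) (by simpa using hα) hd)
  refine (h1.comp_sub_right x).mono'
    (measurable_fracGradIntegrand α (measurable_chi measurableSet_ball) x).aestronglyMeasurable
    (Eventually.of_forall fun y => ?_)
  rw [norm_fracGradIntegrand]
  by_cases hy : dist y x < |dist x x₀ - r|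
  · rw [chi_ball_eq_of_dist_lt hy, sub_self, abs_zero, zero_mul]
    exact indicator_nonneg (fun z _ => by positivity) _
  · rw [indicator_of_mem (by rwa [mem_compl_iff, mem_ball_zero_iff, ← dist_eq_norm])]
    exact mul_le_of_le_one_left (by positivity) (abs_chi_sub_chi_le _ _ _)

theorem lineDeriv_max_norm_sub_rpow {E : Type*} [NormedAddCommGroup E] [InnerProductSpace ℝ E]
    {x y : E} {d : ℝ} (hd : 0 < d) (h : d < ‖y - x‖) (p : ℝ) (e : E) :
    lineDeriv ℝ (fun y : E => (max ‖y - x‖ d) ^ (-p)) y e =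
      -p * ‖y - x‖ ^ (-(p + 2)) * inner ℝ (y - x) e := by
  have h1 : (fun y : E => (max ‖y - x‖ d) ^ (-p)) =ᶠ[𝓝 y] fun y => ‖y - x‖ ^ (-p) := by
    have h2 : ContinuousAt (fun y : E => ‖y - x‖) y := by fun_prop
    filter_upwards [h2.eventually_const_lt h] with z hz
    rw [max_eq_left hz.le]
  have h3 : y ≠ x := by
    rintro rfl
    rw [sub_self, norm_zero] at h
    exact hd.not_gt h
  rw [h1.lineDeriv_eq, (hasLineDerivAt_norm_sub_rpow h3 (-p) e).lineDeriv]
  congr 3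
  ring

/-- The boundary term at infinity: area growth `k ^ m` against kernel decay `k^(-(m+α))` leaves
`k^(-α)`. The kernel bound uses `|k w - x| ≥ k / 2` once `k ≥ 2 |x|`. -/
theorem tendsto_pow_mul_integral_sphere {m : ℕ} {α : ℝ} (hα : 0 < α) (x e : Rn (m + 1)) {d : ℝ}
    (hd : 0 < d) :
    Tendsto (fun k : ℕ => (k : ℝ) ^ m * ∫ w : sphere (0 : Rn (m + 1)) 1,
      (max ‖(k : ℝ) • (w : Rn (m + 1)) - x‖ d) ^ (-(m + α)) * inner ℝ (w : Rn (m + 1)) e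
        ∂(volume : Measure (Rn (m + 1))).toSphere) atTop (𝓝 0) := by
  set σ := (volume : Measure (Rn (m + 1))).toSphere with hσ
  have h1 : Tendsto (fun k : ℕ => 2 ^ ((m : ℝ) + α) * ‖e‖ * σ.real univ * (k : ℝ) ^ (-α)) atTop
      (𝓝 0) := by
    have := ((tendsto_rpow_neg_atTop hα).comp tendsto_natCast_atTop_atTop).const_mul
      (2 ^ ((m : ℝ) + α) * ‖e‖ * σ.real univ)
    rwa [mul_zero] at this
  refine squeeze_zero_norm' ?_ h1
  filter_upwards [eventually_ge_atTop (⌈2 * ‖x‖⌉₊ + 1)] with k hk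
  have hk1 : (0 : ℝ) < k := by exact_mod_cast (Nat.succ_pos _).trans_le hk
  have hk2 : 2 * ‖x‖ ≤ k := (Nat.le_ceil _).trans (by exact_mod_cast (Nat.le_succ _).trans hk)
  have hb : ∀ w : sphere (0 : Rn (m + 1)) 1,
      ‖(max ‖(k : ℝ) • (w : Rn (m + 1)) - x‖ d) ^ (-(m + α)) * inner ℝ (w : Rn (m + 1)) e‖ ≤
        ((k : ℝ) / 2) ^ (-(m + α)) * ‖e‖ := fun w => by
    have hw : ‖(w : Rn (m + 1))‖ = 1 := by simp
    have h2 : (k : ℝ) / 2 ≤ max ‖(k : ℝ) • (w : Rn (m + 1)) - x‖ d := by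
      refine le_trans ?_ (le_max_left _ _)
      have := norm_sub_norm_le ((k : ℝ) • (w : Rn (m + 1))) x
      rw [norm_smul, hw, mul_one, Real.norm_of_nonneg hk1.le] at this
      linarith
    rw [norm_mul, Real.norm_of_nonneg (Real.rpow_nonneg (by positivity) _)]
    refine mul_le_mul ?_ ?_ (norm_nonneg _) (by positivity)
    · exact Real.rpow_le_rpow_of_nonpos (by positivity) h2
        (neg_nonpos.2 (add_nonneg m.cast_nonneg hα.le))
    · simpa [hw] using norm_inner_le_norm (𝕜 := ℝ) (w : Rn (m + 1)) e
  have h3 := norm_integral_le_of_norm_le_const (μ := σ) (Eventually.of_forall hb)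
  rw [norm_mul, Real.norm_of_nonneg (by positivity)]
  refine (mul_le_mul_of_nonneg_left h3 (by positivity)).trans (le_of_eq ?_)
  have h4 : ((k : ℝ) / 2) ^ (-(m + α)) = 2 ^ (m + α) * ((k : ℝ) ^ m)⁻¹ * (k : ℝ) ^ (-α) := by
    rw [Real.div_rpow hk1.le zero_le_two, Real.rpow_neg zero_le_two, div_inv_eq_mul, neg_add,
      Real.rpow_add hk1, Real.rpow_neg hk1.le, Real.rpow_natCast]
    ring
  rw [h4]
  field_simp

/-- The kernel is a multiple of the gradient of the potential `g`, so the divergence theorem turns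
the integral into a flux of `g` through the sphere. -/
theorem integral_inner_fracGradIntegrand_ball_zero {m : ℕ} {α : ℝ} (hα : 0 < α) {r : ℝ} (hr : 0 < r)
    {x : Rn (m + 1)} (hx : x ∉ sphere (0 : Rn (m + 1)) r) (e : Rn (m + 1)) :
    ∫ y, inner ℝ (fracGradIntegrand α (chi (ball 0 r)) x y) e =
      -(m + α)⁻¹ * (r ^ m * ∫ w : sphere (0 : Rn (m + 1)) 1,
        ‖r • (w : Rn (m + 1)) - x‖ ^ (-(m + α)) * inner ℝ (w : Rn (m + 1)) e
          ∂(volume : Measure (Rn (m + 1))).toSphere) := by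
  have hm : Module.finrank ℝ (Rn (m + 1)) = m + 1 := by simp
  have hp : 0 < (m : ℝ) + α := by positivity
  rw [mem_sphere_zero_iff_norm] at hx
  -- Half the gap: the truncation in `g` is then strictly inactive on the sphere and wherever the
  -- integrand is nonzero.
  set d := |‖x‖ - r| / 2 with hd'
  have hd : 0 < d := half_pos (abs_pos.2 (sub_ne_zero.2 hx))
  set g : Rn (m + 1) → ℝ := fun y => (max ‖y - x‖ d) ^ (-(m + α)) with hg'
  obtain ⟨C, hg⟩ := lipschitzWith_max_norm_sub_rpow x hp.le hd
  have hint := integrable_fracGradIntegrand_ball hα (x₀ := 0) (x := x) (r := r)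
    (by rwa [mem_sphere_zero_iff_norm])
  have hgS : ∀ w : sphere (0 : Rn (m + 1)) 1,
      g (r • (w : Rn (m + 1))) = ‖r • (w : Rn (m + 1)) - x‖ ^ (-(m + α)) := fun w => by
    have hw : ‖r • (w : Rn (m + 1))‖ = r := by
      rw [norm_smul, Real.norm_of_nonneg hr.le]; simp
    have := abs_norm_sub_norm_le (r • (w : Rn (m + 1))) x
    rw [hw, abs_sub_comm] at this
    simp only [hg']
    rw [max_eq_left (by linarith)]
  simp_rw [← hgS]
  have hfar : ∀ y, |‖x‖ - r| ≤ ‖y - x‖ → inner ℝ ((‖y - x‖ ^ (((m + 1 : ℕ) : ℝ) + α + 1))⁻¹ •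
      (y - x)) e = -(m + α)⁻¹ * lineDeriv ℝ g y e := fun y hy => by
    rw [lineDeriv_max_norm_sub_rpow hd (by linarith), inner_smul_left,
      ← Real.rpow_neg (norm_nonneg _)]
    have : -(((m + 1 : ℕ) : ℝ) + α + 1) = -(m + α + 2) := by push_cast; ring
    rw [this]
    simp only [conj_trivial]
    field_simp
  rcases lt_or_gt_of_ne hx with hlt | hgt
  -- With `x` inside, the integrand lives on the complement of the ball, exhausted by the shells
  -- `ball 0 k \ ball 0 r`; the outer flux tends to zero.
  · have hin : chi (ball (0 : Rn (m + 1)) r) x = 1 := indicator_of_mem (by simpa using hlt) _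
    have h1 : (fun y => inner ℝ (fracGradIntegrand α (chi (ball 0 r)) x y) e) =
        (ball (0 : Rn (m + 1)) r)ᶜ.indicator fun y => (m + α)⁻¹ * lineDeriv ℝ g y e := by
      ext y
      by_cases hy : y ∈ ball (0 : Rn (m + 1)) r
      · rw [indicator_of_notMem (by simpa using hy), fracGradIntegrand, hin]
        simp [chi, indicator_of_mem hy]
      · rw [indicator_of_mem hy, fracGradIntegrand, hin]
        have hy' := hy
        rw [mem_ball_zero_iff, not_lt] at hy'
        have := hfar y (by
          rw [abs_of_neg (by linarith)]
          linarith [norm_sub_norm_le y x])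
        rw [chi, indicator_of_notMem hy, zero_sub, neg_div, neg_smul, inner_neg_left, one_div, this]
        ring
    have hint' : IntegrableOn (fun y => lineDeriv ℝ g y e) (ball (0 : Rn (m + 1)) r)ᶜ := by
      have := hint.inner_const (𝕜 := ℝ) e
      rw [h1, integrable_indicator_iff measurableSet_ball.compl] at this
      have h2 := this.const_mul ((m : ℝ) + α)
      refine h2.congr (Eventually.of_forall fun y => ?_)
      simp only
      rw [mul_inv_cancel_left₀ hp.ne']
    rw [h1, integral_indicator measurableSet_ball.compl, integral_const_mul]
    have hunion : (⋃ k : ℕ, ball (0 : Rn (m + 1)) k \ ball 0 r) = (ball (0 : Rn (m + 1)) r)ᶜ := by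
      rw [← iUnion_sdiff, iUnion_ball_nat, compl_eq_univ_sdiff]
    have hlim := tendsto_setIntegral_of_monotone (μ := volume)
      (s := fun k : ℕ => ball (0 : Rn (m + 1)) k \ ball 0 r)
      (f := fun y => lineDeriv ℝ g y e) (fun k => measurableSet_ball.diff measurableSet_ball)
      (fun j k hjk => sdiff_subset_sdiff_left (ball_subset_ball (by exact_mod_cast hjk)))
      (by rwa [hunion])
    rw [hunion] at hlim
    have hlim2 := (tendsto_pow_mul_integral_sphere hα x e hd).sub_const
      (r ^ m * ∫ w : sphere (0 : Rn (m + 1)) 1, g (r • (w : Rn (m + 1))) *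
        inner ℝ (w : Rn (m + 1)) e ∂(volume : Measure (Rn (m + 1))).toSphere)
    have heq := tendsto_nhds_unique (hlim.congr' ?_) hlim2
    · rw [heq]; ring
    · filter_upwards [eventually_ge_atTop (⌈r⌉₊ + 1)] with k hk
      have hkr : r ≤ k := (Nat.le_ceil _).trans (by exact_mod_cast (Nat.le_succ _).trans hk)
      rw [setIntegral_sdiff measurableSet_ball _ (ball_subset_ball hkr),
        integral_ball_lineDeriv hm hg e (hr.trans_le hkr), integral_ball_lineDeriv hm hg e hr]
      exact ((hg.locallyIntegrable_lineDeriv e).integrableOn_isCompact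
        (isCompact_closedBall 0 (k : ℝ))).mono_set ball_subset_closedBall
  · have hin : chi (ball (0 : Rn (m + 1)) r) x = 0 :=
      indicator_of_notMem (by simpa using hgt.le) _
    have h1 : (fun y => inner ℝ (fracGradIntegrand α (chi (ball 0 r)) x y) e) =
        (ball (0 : Rn (m + 1)) r).indicator fun y => -(m + α)⁻¹ * lineDeriv ℝ g y e := by
      ext y
      by_cases hy : y ∈ ball (0 : Rn (m + 1)) r
      · rw [indicator_of_mem hy, fracGradIntegrand, hin]
        have hy' := hy
        rw [mem_ball_zero_iff] at hy'
        have := hfar y (by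
          rw [abs_of_pos (by linarith), norm_sub_rev]
          linarith [norm_sub_norm_le x y])
        rw [chi, indicator_of_mem hy, sub_zero, one_div, this]
      · rw [indicator_of_notMem hy, fracGradIntegrand, hin]
        simp [chi, indicator_of_notMem hy]
    rw [h1, integral_indicator measurableSet_ball, integral_const_mul,
      integral_ball_lineDeriv hm hg e hr]

theorem chi_ball_add {n : ℕ} (x₀ y : Rn n) (r : ℝ) :
    chi (ball x₀ r) (x₀ + y) = chi (ball 0 r) y := by
  unfold chi
  by_cases h : ‖y‖ < r
  · rw [indicator_of_mem (by simpa using h), indicator_of_mem (by simpa using h)]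
  · rw [indicator_of_notMem (by simpa using h), indicator_of_notMem (by simpa using h)]

theorem fracGradIntegrand_ball_add {n : ℕ} (α : ℝ) (x₀ x y : Rn n) (r : ℝ) :
    fracGradIntegrand α (chi (ball x₀ r)) x (x₀ + y) =
      fracGradIntegrand α (chi (ball 0 r)) (x - x₀) y := by
  have h1 : x₀ + y - x = y - (x - x₀) := by abel
  have h2 := chi_ball_add x₀ (x - x₀) r
  rw [add_sub_cancel] at h2
  rw [fracGradIntegrand, fracGradIntegrand, h1, chi_ball_add, h2]

theorem continuous_sphere_kernel {m : ℕ} (q : ℝ) {x₀ x : Rn (m + 1)} {r : ℝ} (hr : 0 < r)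
    (hx : x ∉ sphere x₀ r) :
    Continuous fun w : sphere (0 : Rn (m + 1)) 1 => (‖x - (x₀ + r • (w : Rn (m + 1)))‖ ^ q)⁻¹ •
      ((1 / r) • (x₀ + r • (w : Rn (m + 1)) - x₀)) := by
  have h0 : ∀ w : sphere (0 : Rn (m + 1)) 1, 0 < ‖x - (x₀ + r • (w : Rn (m + 1)))‖ := fun w => by
    rw [norm_pos_iff, sub_ne_zero]
    rintro rfl
    apply hx
    rw [mem_sphere_iff_norm, add_sub_cancel_left, norm_smul, Real.norm_of_nonneg hr.le]
    simp
  refine Continuous.smul (Continuous.inv₀ (Continuous.rpow_const (by fun_prop) fun w =>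
    Or.inl (h0 w).ne') fun w => (Real.rpow_pos_of_pos (h0 w) q).ne') (by fun_prop)

/-- The fractional gradient of a ball, as an integral over the sphere. -/
theorem fracGrad_ball_eq_integral_sphere {n : ℕ} (hn : 1 ≤ n) {α : ℝ} (hα : 0 < α) {r : ℝ}
    (hr : 0 < r) {x₀ x : Rn n} (hx : x ∉ sphere x₀ r) :
    IntegrableOn (fun y => (‖x - y‖ ^ ((n : ℝ) + α - 1))⁻¹ • ((1 / r) • (y - x₀)))
        (sphere x₀ r) (Measure.euclideanHausdorffMeasure (n - 1)) ∧
      fracGrad α (chi (ball x₀ r)) x = -(muConst n α / ((n : ℝ) + α - 1)) •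
          ∫ y in sphere x₀ r, (‖x - y‖ ^ ((n : ℝ) + α - 1))⁻¹ • ((1 / r) • (y - x₀))
            ∂(Measure.euclideanHausdorffMeasure (n - 1)) := by
  obtain ⟨m, rfl⟩ : ∃ m, n = m + 1 := ⟨n - 1, by omega⟩
  have hm : Module.finrank ℝ (Rn (m + 1)) = m + 1 := by simp
  have hexp : ((m + 1 : ℕ) : ℝ) + α - 1 = m + α := by push_cast; ring
  rw [Nat.add_sub_cancel, hexp, IntegrableOn, map_toSphere_eq_restrict_sphere hm x₀ hr]
  have hφ : Measurable fun w : sphere (0 : Rn (m + 1)) 1 => x₀ + r • (w : Rn (m + 1)) := by fun_prop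
  have hF : Measurable fun y : Rn (m + 1) =>
      (‖x - y‖ ^ ((m : ℝ) + α))⁻¹ • ((1 / r) • (y - x₀)) := by fun_prop
  have hcont := continuous_sphere_kernel (m + α) hr hx
  have hint : Integrable (fun w : sphere (0 : Rn (m + 1)) 1 =>
      (‖x - (x₀ + r • (w : Rn (m + 1)))‖ ^ ((m : ℝ) + α))⁻¹ •
      ((1 / r) • (x₀ + r • (w : Rn (m + 1)) - x₀))) (volume : Measure (Rn (m + 1))).toSphere :=
    hcont.integrable_of_hasCompactSupport (HasCompactSupport.of_compactSpace _)
  constructor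
  · refine Integrable.smul_measure ?_ ENNReal.ofReal_ne_top
    rw [integrable_map_measure hF.aestronglyMeasurable hφ.aemeasurable]
    exact hint
  · rw [integral_smul_measure, integral_map hφ.aemeasurable hF.aestronglyMeasurable,
      ENNReal.toReal_ofReal (by positivity), fracGrad]
    have hx' : x - x₀ ∉ sphere (0 : Rn (m + 1)) r := by
      rwa [mem_sphere_zero_iff_norm, ← mem_sphere_iff_norm]
    have htrans : ∫ y, fracGradIntegrand α (chi (ball x₀ r)) x y =
        ∫ y, fracGradIntegrand α (chi (ball 0 r)) (x - x₀) y := by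
      rw [← integral_add_left_eq_self _ x₀]
      simp_rw [fracGradIntegrand_ball_add]
    rw [htrans]
    refine ext_inner_left ℝ fun e => ?_
    rw [inner_smul_right, inner_smul_right, inner_smul_right,
      ← integral_inner (integrable_fracGradIntegrand_ball hα hx'), ← integral_inner hint]
    simp_rw [real_inner_comm _ e]
    rw [integral_inner_fracGradIntegrand_ball_zero hα hr hx' e]
    have hw : ∀ w : sphere (0 : Rn (m + 1)) 1,
        inner ℝ ((‖x - (x₀ + r • (w : Rn (m + 1)))‖ ^ ((m : ℝ) + α))⁻¹ •
          ((1 / r) • (x₀ + r • (w : Rn (m + 1)) - x₀))) e =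
        ‖r • (w : Rn (m + 1)) - (x - x₀)‖ ^ (-(m + α)) * inner ℝ (w : Rn (m + 1)) e := fun w => by
      rw [add_sub_cancel_left, one_div, inv_smul_smul₀ hr.ne', inner_smul_left,
        Real.rpow_neg (norm_nonneg _), ← norm_sub_rev (x - x₀), ← sub_sub]
      simp
    simp_rw [hw]
    ring

end FracGradBall

/-! ### The fractional gradient of a ball points inward -/

section Direction

theorem muConst_pos {n : ℕ} {α : ℝ} (hα₀ : 0 < α) (hα₁ : α < 1) : 0 < muConst n α := by
  unfold muConst
  have h1 : 0 < Real.Gamma (((n : ℝ) + α + 1) / 2) := Real.Gamma_pos_of_pos (by positivity)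
  have h2 : 0 < Real.Gamma ((1 - α) / 2) := Real.Gamma_pos_of_pos (by linarith)
  have := Real.pi_pos
  positivity

/-- The fractional gradient of a ball is parallel to the radial direction, by symmetry. -/
theorem integral_fracGradIntegrand_ball_mem_span {n : ℕ} (α : ℝ) (x₀ x : Rn n) (r : ℝ) :
    ∫ y, fracGradIntegrand α (chi (ball x₀ r)) x y ∈ Submodule.span ℝ {x - x₀} := by
  -- The fixed points of `R` are exactly the span, so it suffices that `R` fixes the integral. It
  -- does: the reflection centred at `x` also fixes `x₀`, hence preserves the ball.
  set R := (Submodule.span ℝ {x - x₀}).reflection with hR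
  have hRv : R (x - x₀) = x - x₀ :=
    Submodule.reflection_mem_subspace_eq_self (Submodule.mem_span_singleton_self _)
  rw [← Submodule.reflection_eq_self_iff, ← hR]
  have h1 : ∀ z, fracGradIntegrand α (chi (ball x₀ r)) x (x + R z) =
      R (fracGradIntegrand α (chi (ball x₀ r)) x (x + z)) := fun z => by
    have h2 : ‖x + R z - x₀‖ = ‖x + z - x₀‖ := by
      rw [← R.norm_map (x + z - x₀), add_sub_right_comm, add_sub_right_comm, map_add, hRv]
    have h3 : chi (ball x₀ r) (x + R z) = chi (ball x₀ r) (x + z) := by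
      unfold chi
      by_cases h : ‖x + z - x₀‖ < r
      · rw [indicator_of_mem (by rwa [mem_ball_iff_norm, h2]),
          indicator_of_mem (by rwa [mem_ball_iff_norm])]
      · rw [indicator_of_notMem (by rwa [mem_ball_iff_norm, h2]),
          indicator_of_notMem (by rwa [mem_ball_iff_norm])]
    simp only [fracGradIntegrand, h3, add_sub_cancel_left, R.norm_map, map_smul]
  have h4 : ∫ z, R (fracGradIntegrand α (chi (ball x₀ r)) x (x + z)) =
      R (∫ z, fracGradIntegrand α (chi (ball x₀ r)) x (x + z)) :=
    R.toContinuousLinearEquiv.integral_comp_comm _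
  rw [← integral_add_left_eq_self _ x, ← h4]
  simp_rw [← h1]
  exact R.measurePreserving.integral_comp R.toHomeomorph.measurableEmbedding
    fun z => fracGradIntegrand α (chi (ball x₀ r)) x (x + z)

/-- Pair `z` with its mirror image `R z` in the hyperplane orthogonal to `v`. The one with positive
component along `v` gives the point farther from the centre, so the pair never contributes
positively, and it contributes negatively when the sphere separates the two points. -/
theorem integral_inner_fracGradIntegrand_ball_neg {n : ℕ} {α : ℝ} (hα : 0 < α) {x₀ x : Rn n}
    {r : ℝ} (hr : 0 < r) (hx : x ∉ sphere x₀ r) (hx0 : x ≠ x₀) :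
    ∫ y, inner ℝ (x - x₀) (fracGradIntegrand α (chi (ball x₀ r)) x y) < 0 := by
  set v := x - x₀ with hv'
  have hv : v ≠ 0 := sub_ne_zero.2 hx0
  have hvn : 0 < ‖v‖ := norm_pos_iff.2 hv
  set R := (Submodule.span ℝ {v})ᗮ.reflection with hR
  have hRv : R v = -v := Submodule.reflection_orthogonalComplement_singleton_eq_neg v
  have hRi : ∀ z, inner ℝ v (R z) = -inner ℝ v z := fun z => by
    rw [← R.inner_map_map v (R z), hRv, hR, Submodule.reflection_reflection, inner_neg_left]
  set H : Rn n → ℝ := fun z => inner ℝ v (fracGradIntegrand α (chi (ball x₀ r)) x (x + z)) with hH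
  have hHint : Integrable H :=
    ((integrable_fracGradIntegrand_ball hα hx).comp_add_left x).const_inner v
  have hHR : Integrable fun z => H (R z) :=
    (R.measurePreserving.integrable_comp_emb R.toHomeomorph.measurableEmbedding).2 hHint
  have hmp : ∫ z, H (R z) = ∫ z, H z :=
    R.measurePreserving.integral_comp R.toHomeomorph.measurableEmbedding H
  have hsum : ∀ z, H z + H (R z) = (chi (ball x₀ r) (x + z) - chi (ball x₀ r) (x + R z)) *
      (inner ℝ v z / ‖z‖ ^ ((n : ℝ) + α + 1)) := fun z => by
    simp only [hH, fracGradIntegrand, add_sub_cancel_left, R.norm_map, inner_smul_right, hRi]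
    ring
  have hxz : ∀ z, x + z - x₀ = v + z := fun z => by rw [hv']; abel
  have hn1 : ∀ z, ‖v + z‖ ^ 2 = ‖v‖ ^ 2 + 2 * inner ℝ v z + ‖z‖ ^ 2 := norm_add_sq_real v
  have hn2 : ∀ z, ‖v + R z‖ ^ 2 = ‖v‖ ^ 2 - 2 * inner ℝ v z + ‖z‖ ^ 2 := fun z => by
    rw [norm_add_sq_real, hRi, R.norm_map]; ring
  have hchi1 : ∀ z, ‖v + z‖ < r → chi (ball x₀ r) (x + z) = 1 := fun z h =>
    indicator_of_mem (by rwa [mem_ball_iff_norm, hxz]) _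
  have hchi0 : ∀ z, ¬ ‖v + z‖ < r → chi (ball x₀ r) (x + z) = 0 := fun z h =>
    indicator_of_notMem (by rwa [mem_ball_iff_norm, hxz]) _
  have hnonneg : ∀ z, 0 ≤ -(H z + H (R z)) := fun z => by
    rw [hsum, ← mul_div_assoc, ← neg_div]
    refine div_nonneg ?_ (by positivity)
    by_cases h1 : ‖v + z‖ < r <;> by_cases h2 : ‖v + R z‖ < r
    · rw [hchi1 _ h1, hchi1 _ h2]; simp
    · rw [hchi1 _ h1, hchi0 _ h2]
      have := pow_lt_pow_left₀ (h1.trans_le (not_lt.1 h2)) (norm_nonneg _) two_ne_zero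
      rw [hn1, hn2] at this
      linarith
    · rw [hchi0 _ h1, hchi1 _ h2]
      have := pow_lt_pow_left₀ (h2.trans_le (not_lt.1 h1)) (norm_nonneg _) two_ne_zero
      rw [hn2, hn1] at this
      linarith
    · rw [hchi0 _ h1, hchi0 _ h2]; simp
  have hpos : 0 < ∫ z, -(H z + H (R z)) := by
    rw [integral_pos_iff_support_of_nonneg hnonneg (hHint.add hHR).neg]
    set U : Set (Rn n) := {z | 0 < inner ℝ v z} ∩ ({z | r < ‖v + z‖} ∩ {z | ‖v + R z‖ < r}) with hU
    have hUo : IsOpen U :=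
      (isOpen_lt continuous_const (by fun_prop)).inter
        ((isOpen_lt continuous_const (by fun_prop)).inter
          (isOpen_lt (by have := R.continuous; fun_prop) continuous_const))
    have hUne : U.Nonempty := by
      -- With `t * ‖v‖ = max ‖v‖ r`, the point `v + t • v` has norm above `r`, while its mirror
      -- image has norm `max ‖v‖ r - ‖v‖ < r`.
      set t := max ‖v‖ r / ‖v‖ with ht
      have ht0 : 0 < t := div_pos (hvn.trans_le (le_max_left _ _)) hvn
      have htv : t * ‖v‖ = max ‖v‖ r := div_mul_cancel₀ _ hvn.ne'
      refine ⟨t • v, ?_, ?_, ?_⟩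
      · rw [mem_ofPred_eq, inner_smul_right, real_inner_self_eq_norm_sq]; positivity
      · have : v + t • v = (1 + t) • v := by rw [add_smul, one_smul]
        rw [mem_ofPred_eq, this, norm_smul, Real.norm_of_nonneg (by positivity), add_mul, htv]
        linarith [le_max_right ‖v‖ r]
      · have : v + R (t • v) = (1 - t) • v := by
          rw [map_smul, hRv, sub_smul, one_smul, smul_neg, sub_eq_add_neg]
        rw [mem_ofPred_eq, this, norm_smul, ← norm_norm v, ← norm_mul, sub_mul, htv,
          one_mul, Real.norm_eq_abs]
        rcases max_cases ‖v‖ r with ⟨h, _⟩ | ⟨h, _⟩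
        · rw [h]; simpa using hr
        · rw [h, abs_of_neg (by linarith)]; linarith
    refine (hUo.measure_pos volume hUne).trans_le (measure_mono fun z hz => ?_)
    obtain ⟨h1, h2, h3⟩ := hz
    rw [mem_ofPred_eq] at h1 h2 h3
    rw [Function.mem_support, hsum, hchi0 _ h2.not_gt, hchi1 _ h3]
    have : z ≠ 0 := by rintro rfl; simp at h1
    have hz0 : 0 < ‖z‖ := norm_pos_iff.2 this
    have : 0 < inner ℝ v z / ‖z‖ ^ ((n : ℝ) + α + 1) := by positivity
    simp only [zero_sub, neg_mul, one_mul, neg_neg]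
    exact this.ne'
  rw [integral_neg, integral_add hHint hHR, hmp] at hpos
  have : ∫ y, inner ℝ v (fracGradIntegrand α (chi (ball x₀ r)) x y) = ∫ z, H z :=
    (integral_add_left_eq_self _ x).symm
  rw [this]
  linarith

/-- Away from the centre and the sphere, the fractional gradient of a ball is a negative multiple
of the radial direction. -/
theorem exists_fracGrad_ball_eq_neg_smul {n : ℕ} {α : ℝ} (hα₀ : 0 < α) (hα₁ : α < 1) {x₀ x : Rn n}
    {r : ℝ} (hr : 0 < r) (hx : x ∉ sphere x₀ r) (hx0 : x ≠ x₀) :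
    fracGrad α (chi (ball x₀ r)) x ≠ 0 ∧ fracGrad α (chi (ball x₀ r)) x =
      ‖fracGrad α (chi (ball x₀ r)) x‖ • -(‖x - x₀‖⁻¹ • (x - x₀)) := by
  obtain ⟨t, ht⟩ := Submodule.mem_span_singleton.1
    (integral_fracGradIntegrand_ball_mem_span α x₀ x r)
  have hneg := integral_inner_fracGradIntegrand_ball_neg hα₀ hr hx hx0
  rw [integral_inner (integrable_fracGradIntegrand_ball hα₀ hx), ← ht, inner_smul_right,
    real_inner_self_eq_norm_sq] at hneg
  have hvn : 0 < ‖x - x₀‖ := norm_pos_iff.2 (sub_ne_zero.2 hx0)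
  have ht0 : t < 0 := by
    by_contra h
    have := mul_nonneg (not_lt.1 h) (sq_nonneg ‖x - x₀‖)
    linarith
  have hμ := muConst_pos (n := n) hα₀ hα₁
  have hg : fracGrad α (chi (ball x₀ r)) x = (muConst n α * t) • (x - x₀) := by
    rw [fracGrad, ← ht, smul_smul]
  have hc : muConst n α * t < 0 := mul_neg_of_pos_of_neg hμ ht0
  rw [hg]
  refine ⟨smul_ne_zero hc.ne (sub_ne_zero.2 hx0), ?_⟩
  rw [norm_smul, Real.norm_of_nonpos hc.le, smul_neg, smul_smul, mul_assoc,
    mul_inv_cancel₀ hvn.ne', mul_one, neg_smul, neg_neg]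

end Direction

/-! ### Fractional integration by parts -/

section IntegrationByParts

theorem integrable_chi_ball {n : ℕ} (x₀ : Rn n) (r : ℝ) : Integrable (chi (ball x₀ r)) :=
  (integrable_indicator_iff measurableSet_ball).2 (integrableOn_const measure_ball_lt_top.ne)

/-- The kernel controlling difference quotients of Lipschitz functions is integrable. -/
theorem integrable_min_norm_one_mul_rpow {n : ℕ} (hn : 1 ≤ n) {α : ℝ} (hα₀ : 0 < α) (hα₁ : α < 1) :
    Integrable fun z : Rn n => min ‖z‖ 1 * ‖z‖ ^ (-((n : ℝ) + α)) := by
  have : Nontrivial (Rn n) := Module.nontrivial_of_finrank_pos (R := ℝ) (by simpa using Nat.zero_lt_of_lt hn)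
  rw [← integrableOn_univ, ← union_compl_self (ball (0 : Rn n) 1), integrableOn_union]
  constructor
  -- Near the origin the radial integrand is `s^(n-1) * s * s^(-(n+α)) = s^(-α)`, integrable because
  -- `α < 1`.
  · rw [integrableOn_fun_norm_addHaar volume
      (f := fun s : ℝ => min s 1 * s ^ (-((n : ℝ) + α)))]
    have h1 : IntegrableOn (fun y : ℝ => y ^ (-α)) (Ioo 0 1) :=
      (intervalIntegral.integrableOn_Ioo_rpow_iff one_pos).2 (by linarith)
    refine h1.congr_fun (fun y hy => ?_) measurableSet_Ioo
    have hy0 : 0 < y := hy.1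
    simp only [finrank_euclideanSpace, Fintype.card_fin, smul_eq_mul]
    rw [min_eq_left hy.2.le, ← mul_assoc, ← pow_succ, Nat.sub_add_cancel hn, ← Real.rpow_natCast,
      ← Real.rpow_add hy0]
    congr 1; ring
  · refine (integrableOn_compl_ball_norm_rpow (E := Rn n) (μ := volume) (q := n + α)
      (by simpa using hα₀) one_pos).congr_fun (fun z hz => ?_) measurableSet_ball.compl
    rw [mem_compl_iff, mem_ball_zero_iff, not_lt] at hz
    simp only
    rw [min_eq_right hz, one_mul]

/-- Translating a ball changes it by a set whose volume is linear in the translation. -/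
theorem exists_integral_abs_chi_ball_add_sub_le {n : ℕ} (hn : 1 ≤ n) (x₀ : Rn n) {r : ℝ}
    (hr : 0 < r) : ∃ C : ℝ, 0 ≤ C ∧ ∀ w : Rn n,
      ∫ y, |chi (ball x₀ r) (y + w) - chi (ball x₀ r) y| ≤ C * min ‖w‖ 1 := by
  have : Nontrivial (Rn n) := Module.nontrivial_of_finrank_pos (R := ℝ) (by simpa using Nat.zero_lt_of_lt hn)
  set V := (volume : Measure (Rn n)).real (ball 0 1) with hV
  have hV0 : 0 ≤ V := measureReal_nonneg
  have hI := integrable_chi_ball x₀ r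
  set A := 2 * ∫ y, |chi (ball x₀ r) y| with hA
  have hA0 : 0 ≤ A := mul_nonneg zero_le_two (integral_nonneg fun y => abs_nonneg _)
  set B := 2 * n * (2 * r) ^ (n - 1) * V with hB
  have hB0 : 0 ≤ B := by positivity
  have b1 : ∀ w : Rn n, ∫ y, |chi (ball x₀ r) (y + w) - chi (ball x₀ r) y| ≤ A := fun w => by
    have h1 : ∫ y, |chi (ball x₀ r) (y + w)| = ∫ y, |chi (ball x₀ r) y| :=
      integral_add_right_eq_self (fun y => |chi (ball x₀ r) y|) w
    calc _ ≤ ∫ y, (|chi (ball x₀ r) (y + w)| + |chi (ball x₀ r) y|) :=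
          integral_mono (((hI.comp_add_right w).sub hI).abs)
            ((hI.comp_add_right w).abs.add hI.abs) fun y => abs_sub _ _
      _ = A := by
          rw [integral_add (hI.comp_add_right w).abs hI.abs, h1, hA]; ring
  have b2 : ∀ w : Rn n, ‖w‖ ≤ r →
      ∫ y, |chi (ball x₀ r) (y + w) - chi (ball x₀ r) y| ≤ B * ‖w‖ := fun w hw => by
    -- A translation by `w` can change the indicator only at points within `‖w‖` of the sphere.
    set S := closedBall x₀ (r + ‖w‖) \ ball x₀ (r - ‖w‖) with hS
    have hSm : MeasurableSet S := measurableSet_closedBall.diff measurableSet_ball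
    have hSi : Integrable (S.indicator fun _ : Rn n => (1 : ℝ)) :=
      (integrable_indicator_iff hSm).2 (integrableOn_const
        ((measure_mono sdiff_subset).trans_lt measure_closedBall_lt_top).ne)
    calc _ ≤ ∫ y, S.indicator (fun _ => (1 : ℝ)) y := by
          refine integral_mono (((hI.comp_add_right w).sub hI).abs) hSi fun y => ?_
          by_cases hy : y ∈ S
          · rw [indicator_of_mem hy]; exact abs_chi_sub_chi_le _ _ _
          · rw [indicator_of_notMem hy]
            have h2 : dist (y + w) y < |dist y x₀ - r| := by
              rw [dist_self_add_left]
              by_contra h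
              rw [not_lt, abs_le] at h
              exact hy ⟨by rw [mem_closedBall]; linarith, by rw [mem_ball]; linarith⟩
            simp only
            rw [chi_ball_eq_of_dist_lt h2, sub_self, abs_zero]
      _ = ((r + ‖w‖) ^ n - (r - ‖w‖) ^ n) * V := by
          rw [integral_indicator hSm, setIntegral_const, smul_eq_mul, mul_one, measureReal_sdiff
            (ball_subset_closedBall.trans (closedBall_subset_closedBall
              (by linarith [norm_nonneg w]))) measurableSet_ball measure_closedBall_lt_top.ne,
            ← Measure.addHaar_real_closedBall_eq_addHaar_real_ball,
            Measure.addHaar_real_closedBall _ _ (by positivity),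
            Measure.addHaar_real_closedBall _ _ (by linarith)]
          simp only [finrank_euclideanSpace, Fintype.card_fin]
          ring
      _ ≤ (2 * ‖w‖ * n * (2 * r) ^ (n - 1)) * V := by
          refine mul_le_mul_of_nonneg_right ?_ hV0
          refine (le_abs_self _).trans ((abs_pow_sub_pow_le _ _ _).trans ?_)
          have h3 : r + ‖w‖ - (r - ‖w‖) = 2 * ‖w‖ := by ring
          rw [h3, abs_of_nonneg (by positivity : 0 ≤ 2 * ‖w‖),
            abs_of_nonneg (by positivity : 0 ≤ r + ‖w‖),
            abs_of_nonneg (by linarith : 0 ≤ r - ‖w‖)]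
          gcongr
          exact max_le (by linarith) (by linarith [norm_nonneg w])
      _ = B * ‖w‖ := by rw [hB]; ring
  -- `B` serves `‖w‖ ≤ min r 1`, `A / r` serves `r ≤ ‖w‖ ≤ 1`, and `A` serves `‖w‖ ≥ 1`.
  refine ⟨A + B + A / r, by positivity, fun w => ?_⟩
  have hAr : 0 ≤ A / r := by positivity
  rcases le_total ‖w‖ 1 with h | h
  · rw [min_eq_left h]
    rcases le_total ‖w‖ r with h' | h'
    · refine (b2 w h').trans (mul_le_mul_of_nonneg_right (by linarith) (norm_nonneg _))
    · have h4 : A ≤ A / r * ‖w‖ := by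
        rw [div_mul_eq_mul_div, le_div_iff₀ hr]
        exact mul_le_mul_of_nonneg_left h' hA0
      refine (b1 w).trans (h4.trans (mul_le_mul_of_nonneg_right (by linarith) (norm_nonneg _)))
  · rw [min_eq_right h]
    linarith [b1 w]

/-- The kernel `z ↦ z / |z| ^ (n + α + 1)` of the fractional gradient. -/
noncomputable def fracKernel {n : ℕ} (α : ℝ) (z : Rn n) : Rn n := (‖z‖ ^ ((n : ℝ) + α + 1))⁻¹ • z

theorem measurable_fracKernel {n : ℕ} (α : ℝ) : Measurable (fracKernel (n := n) α) := by
  unfold fracKernel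
  fun_prop

theorem norm_fracKernel {n : ℕ} {α : ℝ} (hα : 0 < α) (z : Rn n) :
    ‖fracKernel α z‖ = ‖z‖ ^ (-((n : ℝ) + α)) := by
  rcases eq_or_ne z 0 with rfl | h
  -- A real power of zero with nonzero exponent is zero, even for a negative one, so the identity
  -- survives at the origin.
  · rw [fracKernel, smul_zero, norm_zero, Real.zero_rpow (by
      have : (0 : ℝ) ≤ n := n.cast_nonneg
      linarith)]
  · have h0 : 0 < ‖z‖ := norm_pos_iff.2 h
    rw [fracKernel, norm_smul, norm_inv, Real.norm_of_nonneg (by positivity),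
      Real.rpow_add_one h0.ne', Real.rpow_neg h0.le]
    field_simp

theorem fracKernel_neg {n : ℕ} (α : ℝ) (z : Rn n) : fracKernel α (-z) = -fracKernel α z := by
  simp [fracKernel]

theorem fracGrad_eq_integral_kernel {n : ℕ} (α : ℝ) (f : Rn n → ℝ) (x : Rn n) :
    fracGrad α f x = muConst n α • ∫ z, (f (x + z) - f x) • fracKernel α z := by
  rw [fracGrad, ← integral_add_left_eq_self _ x]
  congr 2
  ext1 z
  rw [fracGradIntegrand, add_sub_cancel_left, fracKernel, smul_smul, div_eq_mul_inv]

theorem fracDiv_eq_integral_kernel {n : ℕ} (α : ℝ) (φ : Rn n → Rn n) (x : Rn n) :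
    fracDiv α φ x = muConst n α * ∫ z, inner ℝ (φ (x + z) - φ x) (fracKernel α z) := by
  rw [fracDiv, ← integral_add_left_eq_self _ x]
  congr 2
  ext1 z
  rw [add_sub_cancel_left, fracKernel, inner_smul_right, div_eq_inv_mul]

/-- Integrable functions whose difference quotients are controlled in `L¹` have finite
`α`-Gagliardo seminorm. -/
theorem integrable_prod_sub_smul_fracKernel {n : ℕ} (hn : 1 ≤ n) {α : ℝ} (hα₀ : 0 < α)
    (hα₁ : α < 1) {f : Rn n → ℝ} (hf : Measurable f) (hI : Integrable f) {C : ℝ}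
    (hC : ∀ w : Rn n, ∫ y, |f (y + w) - f y| ≤ C * min ‖w‖ 1) :
    Integrable (fun p : Rn n × Rn n => (f (p.1 + p.2) - f p.1) • fracKernel α p.2)
      (volume.prod volume) := by
  have hk := measurable_fracKernel (n := n) α
  have hmeas : Measurable fun p : Rn n × Rn n => (f (p.1 + p.2) - f p.1) • fracKernel α p.2 := by
    fun_prop
  -- Integrating in `x` first leaves the `L¹` modulus of continuity times `|z|^(-(n+α))`, dominated
  -- by the integrable kernel.
  rw [integrable_prod_iff' hmeas.aestronglyMeasurable]
  have hdiff : ∀ z, Integrable fun x => f (x + z) - f x := fun z => (hI.comp_add_right z).sub hI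
  refine ⟨Eventually.of_forall fun z => (hdiff z).smul_const (fracKernel α z), ?_⟩
  have heq : (fun z : Rn n => ∫ x : Rn n, ‖(f (x + z) - f x) • fracKernel α z‖) =
      fun z => (∫ x, |f (x + z) - f x|) * ‖z‖ ^ (-((n : ℝ) + α)) := by
    ext z
    simp only [norm_smul, norm_fracKernel hα₀, Real.norm_eq_abs]
    rw [integral_mul_const]
  have hmeas2 : AEStronglyMeasurable
      (fun z : Rn n => ∫ x : Rn n, ‖(f (x + z) - f x) • fracKernel α z‖) volume :=
    hmeas.norm.stronglyMeasurable.integral_prod_left'.aestronglyMeasurable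
  simp only
  rw [heq] at hmeas2 ⊢
  refine ((integrable_min_norm_one_mul_rpow hn hα₀ hα₁).const_mul C).mono' hmeas2
    (Eventually.of_forall fun z => ?_)
  rw [Real.norm_of_nonneg (mul_nonneg (integral_nonneg fun x => abs_nonneg _) (by positivity)),
    ← mul_assoc]
  exact mul_le_mul_of_nonneg_right (hC z) (by positivity)

theorem exists_norm_sub_le_mul_min {n : ℕ} {φ : Rn n → Rn n} (hφ : ContDiff ℝ ∞ φ)
    (hc : HasCompactSupport φ) : ∃ C : ℝ, 0 ≤ C ∧ ∀ x z, ‖φ (x + z) - φ x‖ ≤ C * min ‖z‖ 1 := by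
  obtain ⟨L, hL⟩ := hφ.lipschitzWith_of_hasCompactSupport hc (by simp)
  obtain ⟨M, hM⟩ := hc.exists_bound_of_continuous hφ.continuous
  have hM0 : 0 ≤ M := (norm_nonneg _).trans (hM 0)
  refine ⟨L + 2 * M, by positivity, fun x z => ?_⟩
  rcases le_total ‖z‖ 1 with h | h
  · rw [min_eq_left h]
    have := hL.norm_sub_le (x + z) x
    rw [add_sub_cancel_left] at this
    nlinarith [norm_nonneg z]
  · rw [min_eq_right h]
    have := norm_sub_le (φ (x + z)) (φ x)
    linarith [hM (x + z), hM x, L.coe_nonneg]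

/-- Fractional integration by parts. -/
theorem integral_mul_fracDiv {n : ℕ} (hn : 1 ≤ n) {α : ℝ} (hα₀ : 0 < α) (hα₁ : α < 1)
    {f : Rn n → ℝ} (hf : Integrable f) (hG : Integrable (fun p : Rn n × Rn n =>
      (f (p.1 + p.2) - f p.1) • fracKernel α p.2) (volume.prod volume))
    {φ : Rn n → Rn n} (hφ : ContDiff ℝ ∞ φ) (hc : HasCompactSupport φ) :
    ∫ x, f x * fracDiv α φ x = - ∫ x, inner ℝ (φ x) (fracGrad α f x) := by
  obtain ⟨C, hC0, hC⟩ := exists_norm_sub_le_mul_min hφ hc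
  obtain ⟨M, hM⟩ := hc.exists_bound_of_continuous hφ.continuous
  have hφc := hφ.continuous
  have hk := measurable_fracKernel (n := n) α
  have hH1 : Integrable (Function.uncurry fun x z : Rn n =>
      f x * inner ℝ (φ (x + z) - φ x) (fracKernel α z)) (volume.prod volume) := by
    refine (hf.norm.mul_prod
      ((integrable_min_norm_one_mul_rpow hn hα₀ hα₁).const_mul C)).mono' ?_ ?_
    · refine AEStronglyMeasurable.mul hf.aestronglyMeasurable.comp_fst ?_
      exact Measurable.aestronglyMeasurable (by fun_prop)
    · refine Eventually.of_forall fun p => ?_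
      rw [Function.uncurry, norm_mul]
      refine mul_le_mul_of_nonneg_left ?_ (norm_nonneg _)
      refine (norm_inner_le_norm _ _).trans ?_
      rw [norm_fracKernel hα₀, ← mul_assoc]
      exact mul_le_mul_of_nonneg_right (hC _ _) (by positivity)
  have hH2 : Integrable (Function.uncurry fun y w : Rn n =>
      inner ℝ (φ y) ((f (y + w) - f y) • fracKernel α w)) (volume.prod volume) := by
    refine (hG.norm.const_mul M).mono' ?_ ?_
    · refine AEStronglyMeasurable.inner ?_ hG.aestronglyMeasurable
      exact (hφc.comp continuous_fst).aestronglyMeasurable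
    · refine Eventually.of_forall fun p => ?_
      refine (norm_inner_le_norm _ _).trans ?_
      exact mul_le_mul_of_nonneg_right (hM _) (norm_nonneg _)
  have e1 : ∫ x, f x * fracDiv α φ x = muConst n α *
      ∫ z, ∫ x, f x * inner ℝ (φ (x + z) - φ x) (fracKernel α z) := by
    rw [← integral_integral_swap hH1, ← integral_const_mul]
    congr 1
    ext1 x
    rw [fracDiv_eq_integral_kernel, integral_const_mul]
    ring
  have e2 : ∫ x, inner ℝ (φ x) (fracGrad α f x) = muConst n α *
      ∫ w, ∫ y, inner ℝ (φ y) ((f (y + w) - f y) • fracKernel α w) := by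
    rw [← integral_integral_swap hH2, ← integral_const_mul]
    refine integral_congr_ae ?_
    filter_upwards [hG.prod_right_ae] with x hx
    rw [fracGrad_eq_integral_kernel, inner_smul_right, integral_inner hx]
  -- After Fubini, `z` is replaced by `-z` on the divergence side. At fixed `z` the terms of the
  -- differences are separately integrable, and a translation in `x` matches them.
  rw [e1, e2, ← integral_neg_eq_self, ← mul_neg, ← integral_neg]
  congr 2
  ext1 z
  simp only [fracKernel_neg]
  set a : Rn n → ℝ := fun x => inner ℝ (φ x) (fracKernel α z) with ha
  have hac : Continuous a := by fun_prop
  have hab : ∀ x, ‖a x‖ ≤ M * ‖fracKernel α z‖ := fun x =>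
    (norm_inner_le_norm _ _).trans (mul_le_mul_of_nonneg_right (hM _) (norm_nonneg _))
  have i1 : Integrable fun x => f x * a x :=
    hf.mul_bdd hac.aestronglyMeasurable (Eventually.of_forall hab)
  have i2 : Integrable fun x => f x * a (x + -z) :=
    hf.mul_bdd (hac.comp (continuous_add_const _)).aestronglyMeasurable
      (Eventually.of_forall fun x => hab _)
  have i3 : Integrable fun x => f (x + z) * a x :=
    (hf.comp_add_right z).mul_bdd hac.aestronglyMeasurable (Eventually.of_forall hab)
  have h1 : ∀ x, f x * inner ℝ (φ (x + -z) - φ x) (-fracKernel α z) =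
      f x * a x - f x * a (x + -z) := fun x => by
    simp only [ha, inner_neg_right, inner_sub_left]; ring
  have h2 : ∀ x, inner ℝ (φ x) ((f (x + z) - f x) • fracKernel α z) =
      f (x + z) * a x - f x * a x := fun x => by
    simp only [ha, inner_smul_right]; ring
  have h3 : ∫ x, f (x + z) * a x = ∫ x, f x * a (x + -z) := by
    rw [← integral_add_right_eq_self (fun x => f x * a (x + -z)) z]
    simp
  simp_rw [h1, h2]
  rw [integral_sub i1 i2, integral_sub i3 i1, h3]
  ring

end IntegrationByParts

/-! ### Uniqueness of vector Radon measures; averages on small balls -/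

section Uniqueness

theorem VectorRadonMeasure.locallyIntegrable_density {n : ℕ} (D : VectorRadonMeasure n) :
    LocallyIntegrable D.density D.variation := by
  have := D.locallyFinite
  exact (memLp_top_of_bound D.measurable_density.aestronglyMeasurable 1
    (D.norm_density.mono fun x hx => hx.le)).locallyIntegrable le_top

/-- Recovers the scalar density of the variation from the vector density. The polar field may fail
to be unit on a set charged by `m`, but there the scalar density is zero almost everywhere. -/
theorem VectorRadonMeasure.norm_rnDeriv_smul_density {n : ℕ} (D : VectorRadonMeasure n)
    (m : Measure (Rn n)) [SigmaFinite m] (h : D.variation ≪ m) :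
    ∀ᵐ x ∂m, ‖(D.variation.rnDeriv m x).toReal • D.density x‖ =
      (D.variation.rnDeriv m x).toReal := by
  have := D.locallyFinite
  have h1 := D.norm_density
  rw [← Measure.withDensity_rnDeriv_eq _ _ h, ae_withDensity_iff (Measure.measurable_rnDeriv _ _)]
    at h1
  filter_upwards [h1] with x hx
  by_cases h0 : D.variation.rnDeriv m x = 0
  · simp [h0]
  · rw [norm_smul, hx h0, mul_one, Real.norm_of_nonneg ENNReal.toReal_nonneg]

theorem VectorRadonMeasure.locallyIntegrable_rnDeriv_smul {n : ℕ} (D : VectorRadonMeasure n)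
    (m : Measure (Rn n)) [SigmaFinite m] (h : D.variation ≪ m) :
    LocallyIntegrable (fun x => (D.variation.rnDeriv m x).toReal • D.density x) m := by
  have := D.locallyFinite
  rw [locallyIntegrable_iff]
  intro K hK
  rw [← integrable_indicator_iff hK.measurableSet]
  have h1 : Integrable (K.indicator D.density) D.variation :=
    (integrable_indicator_iff hK.measurableSet).2
      (D.locallyIntegrable_density.integrableOn_isCompact hK)
  refine ((integrable_rnDeriv_smul_iff h).2 h1).congr (Eventually.of_forall fun x => ?_)
  by_cases hx : x ∈ K <;> simp [hx]

/-- A vector-valued Radon measure is determined by its action on test fields. -/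
theorem VectorRadonMeasure.eq_of_forall_integral_inner_eq {n : ℕ} {D₁ D₂ : VectorRadonMeasure n}
    (h : ∀ φ : Rn n → Rn n, ContDiff ℝ ∞ φ → HasCompactSupport φ →
      ∫ x, inner ℝ (φ x) (D₁.density x) ∂D₁.variation =
        ∫ x, inner ℝ (φ x) (D₂.density x) ∂D₂.variation) :
    D₁.variation = D₂.variation ∧ D₁.density =ᵐ[D₁.variation] D₂.density := by
  have := D₁.locallyFinite
  have := D₂.locallyFinite
  -- Both variations have densities with respect to their sum. Test fields `g • e` identify the
  -- vector densities, their norms then identify the variations, and cancelling the scalar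
  -- identifies the polar fields.
  set m := D₁.variation + D₂.variation with hm
  have h1 : D₁.variation ≪ m := Measure.AbsolutelyContinuous.rfl.add_right _
  have h2 : D₂.variation ≪ m := by
    rw [hm, add_comm]; exact Measure.AbsolutelyContinuous.rfl.add_right _
  have hsmul : ∀ g : Rn n → ℝ, ContDiff ℝ ∞ g → HasCompactSupport g →
      ∫ x, g x • D₁.density x ∂D₁.variation = ∫ x, g x • D₂.density x ∂D₂.variation :=
    fun g hg hgc => by
    refine ext_inner_left ℝ fun e => ?_
    rw [← integral_inner (D₁.locallyIntegrable_density.integrable_smul_left_of_hasCompactSupport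
        hg.continuous hgc),
      ← integral_inner (D₂.locallyIntegrable_density.integrable_smul_left_of_hasCompactSupport
        hg.continuous hgc)]
    have := h (fun x => g x • e) (hg.smul contDiff_const) hgc.smul_right
    simpa only [inner_smul_left, inner_smul_right, conj_trivial] using this
  have hae : ∀ᵐ x ∂m, (D₁.variation.rnDeriv m x).toReal • D₁.density x =
      (D₂.variation.rnDeriv m x).toReal • D₂.density x := by
    refine ae_eq_of_integral_contDiff_smul_eq (D₁.locallyIntegrable_rnDeriv_smul m h1)
      (D₂.locallyIntegrable_rnDeriv_smul m h2) fun g hg hgc => ?_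
    simp_rw [smul_comm (g _)]
    rw [integral_rnDeriv_smul h1 (f := fun x => g x • D₁.density x),
      integral_rnDeriv_smul h2 (f := fun x => g x • D₂.density x)]
    exact hsmul g hg hgc
  have hrn : D₁.variation.rnDeriv m =ᵐ[m] D₂.variation.rnDeriv m := by
    filter_upwards [hae, D₁.norm_rnDeriv_smul_density m h1, D₂.norm_rnDeriv_smul_density m h2,
      Measure.rnDeriv_lt_top D₁.variation m, Measure.rnDeriv_lt_top D₂.variation m]
      with x hx h1x h2x h1t h2t
    rw [hx, h2x] at h1x
    exact ((ENNReal.toReal_eq_toReal_iff' h2t.ne h1t.ne).1 h1x).symm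
  constructor
  · rw [← Measure.withDensity_rnDeriv_eq _ _ h1, withDensity_congr_ae hrn,
      Measure.withDensity_rnDeriv_eq _ _ h2]
  · rw [EventuallyEq]
    nth_rewrite 1 [← Measure.withDensity_rnDeriv_eq _ _ h1]
    rw [ae_withDensity_iff (Measure.measurable_rnDeriv _ _)]
    filter_upwards [hae, hrn, Measure.rnDeriv_lt_top D₁.variation m] with x hx hr ht h0
    rw [← hr] at hx
    exact smul_right_injective _ (ENNReal.toReal_ne_zero.2 ⟨h0, ht.ne⟩) hx

/-- Averages of `u` over small balls stay in any closed ball about `u x` containing the values, by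
convexity. -/
theorem tendsto_average_ball {n : ℕ} {μ : Measure (Rn n)} [IsFiniteMeasure μ] {u : Rn n → Rn n}
    {x : Rn n} (hx : ∀ ρ > 0, μ (ball x ρ) ≠ 0) (hu : Integrable u μ) (hc : ContinuousAt u x) :
    Tendsto (fun ρ => (μ.real (ball x ρ))⁻¹ • ∫ y in ball x ρ, u y ∂μ) (𝓝[>] 0) (𝓝 (u x)) := by
  rw [Metric.tendsto_nhdsWithin_nhds]
  intro ε hε
  obtain ⟨δ, hδ, h⟩ := Metric.continuousAt_iff.1 hc (ε / 2) (half_pos hε)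
  refine ⟨δ, hδ, fun {ρ} hρ hρδ => ?_⟩
  rw [Real.dist_0_eq_abs, abs_of_pos hρ] at hρδ
  rw [← setAverage_eq]
  have := (convex_closedBall (u x) (ε / 2)).set_average_mem isClosed_closedBall (hx ρ hρ)
    (measure_ne_top _ _) ((ae_restrict_mem measurableSet_ball).mono fun y hy =>
      (h (lt_trans hy hρδ)).le) hu.integrableOn
  rw [mem_closedBall] at this
  linarith

end Uniqueness

/-! ### The measure-theoretic boundary of a ball -/

section EssentialBoundary

theorem mem_densityPoints_one_of_mem_nhds {n : ℕ} {A : Set (Rn n)} {x : Rn n} (h : A ∈ 𝓝 x) :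
    x ∈ densityPoints A 1 := by
  obtain ⟨ε, hε, hA⟩ := Metric.mem_nhds_iff.1 h
  refine Tendsto.congr' ?_ tendsto_const_nhds
  filter_upwards [Ioo_mem_nhdsGT hε] with ρ hρ
  rw [inter_eq_self_of_subset_right ((ball_subset_ball hρ.2.le).trans hA), div_self]
  exact (ENNReal.toReal_pos (measure_ball_pos _ _ hρ.1).ne' measure_ball_lt_top.ne).ne'

theorem mem_densityPoints_zero_of_compl_mem_nhds {n : ℕ} {A : Set (Rn n)} {x : Rn n}
    (h : Aᶜ ∈ 𝓝 x) : x ∈ densityPoints A 0 := by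
  obtain ⟨ε, hε, hA⟩ := Metric.mem_nhds_iff.1 h
  refine Tendsto.congr' ?_ tendsto_const_nhds
  filter_upwards [Ioo_mem_nhdsGT hε] with ρ hρ
  have : A ∩ ball x ρ = ∅ := by
    rw [← disjoint_iff_inter_eq_empty, disjoint_comm, ← subset_compl_iff_disjoint_right]
    exact (ball_subset_ball hρ.2.le).trans hA
  rw [this]
  simp

theorem volume_real_ball_half_div {n : ℕ} (x y : Rn n) {ρ : ℝ} (hρ : 0 < ρ) :
    volume.real (ball y (ρ / 2)) = (1 / 2) ^ n * volume.real (ball x ρ) := by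
  rw [Measure.real, Measure.real, Measure.addHaar_ball_of_pos _ _ hρ,
    Measure.addHaar_ball_of_pos _ _ (half_pos hρ), ENNReal.toReal_mul, ENNReal.toReal_mul,
    ENNReal.toReal_ofReal (by positivity), ENNReal.toReal_ofReal (by positivity),
    finrank_euclideanSpace, Fintype.card_fin, div_pow, div_pow]
  ring

/-- A point near which a set contains balls of comparable size is not a point of density zero. -/
theorem notMem_densityPoints_zero {n : ℕ} {A : Set (Rn n)} {x : Rn n} {c : ℝ → Rn n}
    (h : ∀ᶠ ρ in 𝓝[>] (0 : ℝ), ball (c ρ) (ρ / 2) ⊆ A ∩ ball x ρ) : x ∉ densityPoints A 0 := by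
  intro h0
  have h1 : ∀ᶠ ρ in 𝓝[>] (0 : ℝ),
      (1 / 2 : ℝ) ^ n ≤ volume.real (A ∩ ball x ρ) / volume.real (ball x ρ) := by
    filter_upwards [h, self_mem_nhdsWithin] with ρ hρ hρ0
    have hV : 0 < volume.real (ball x ρ) :=
      ENNReal.toReal_pos (measure_ball_pos _ _ hρ0).ne' measure_ball_lt_top.ne
    rw [le_div_iff₀ hV, ← volume_real_ball_half_div x (c ρ) hρ0]
    exact measureReal_mono hρ ((measure_mono inter_subset_right).trans_lt measure_ball_lt_top).ne
  have := ge_of_tendsto h0 h1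
  have : (0 : ℝ) < (1 / 2) ^ n := by positivity
  linarith

/-- If the set had density one, its complement would have density zero. -/
theorem notMem_densityPoints_one {n : ℕ} {A : Set (Rn n)} (hA : MeasurableSet A) {x : Rn n}
    {c : ℝ → Rn n} (h : ∀ᶠ ρ in 𝓝[>] (0 : ℝ), ball (c ρ) (ρ / 2) ⊆ Aᶜ ∩ ball x ρ) :
    x ∉ densityPoints A 1 := by
  intro h1
  refine notMem_densityPoints_zero h ?_
  have h2 := (tendsto_const_nhds (x := (1 : ℝ))).sub h1
  rw [sub_self] at h2
  refine h2.congr' ?_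
  filter_upwards [self_mem_nhdsWithin] with ρ hρ0
  have hV : 0 < volume.real (ball x ρ) :=
    ENNReal.toReal_pos (measure_ball_pos _ _ hρ0).ne' measure_ball_lt_top.ne
  have h3 := measureReal_inter_add_sdiff (μ := volume) (s := ball x ρ) hA measure_ball_lt_top.ne
  rw [inter_comm, sdiff_eq, inter_comm (ball x ρ)] at h3
  rw [eq_div_iff hV.ne', sub_mul, div_mul_cancel₀ _ hV.ne']
  linarith

/-- At a point of the sphere, balls of radius `ρ / 2` shifted by `ρ / 2` along the inward and
outward normals lie inside and outside the ball respectively, excluding both densities. -/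
theorem essBoundary_ball {n : ℕ} (x₀ : Rn n) {r : ℝ} (hr : 0 < r) :
    essBoundary (ball x₀ r) = sphere x₀ r := by
  ext x
  rw [essBoundary, mem_compl_iff, mem_union, not_or]
  constructor
  · rintro ⟨h0, h1⟩
    rcases lt_trichotomy (dist x x₀) r with h | h | h
    · exact absurd (mem_densityPoints_one_of_mem_nhds (isOpen_ball.mem_nhds h)) h1
    · exact h
    · refine absurd (mem_densityPoints_zero_of_compl_mem_nhds ?_) h0
      filter_upwards [isClosed_closedBall.isOpen_compl.mem_nhds
        (show x ∈ (closedBall x₀ r)ᶜ by simpa using h)] with y hy hy'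
      exact hy (ball_subset_closedBall hy')
  · intro hx
    rw [mem_sphere_iff_norm] at hx
    set u := r⁻¹ • (x - x₀) with hu
    have hun : ‖u‖ = 1 := by
      rw [hu, norm_smul, hx, norm_inv, Real.norm_of_nonneg hr.le, inv_mul_cancel₀ hr.ne']
    have hxu : x - x₀ = r • u := by rw [hu, smul_inv_smul₀ hr.ne']
    have hball : ∀ ρ > 0, ∀ s : ℝ, |s| = ρ / 2 → ball (x + s • u) (ρ / 2) ⊆ ball x ρ :=
      fun ρ hρ s hs => ball_subset_ball' (by
        rw [dist_self_add_left, norm_smul, hun, Real.norm_eq_abs, hs]; linarith)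
    constructor
    · refine notMem_densityPoints_zero (c := fun ρ => x + (-(ρ / 2)) • u) ?_
      filter_upwards [Ioo_mem_nhdsGT hr] with ρ hρ
      have hρ0 : 0 < ρ := hρ.1
      refine subset_inter (ball_subset_ball' ?_)
        (hball ρ hρ0 _ (by rw [abs_neg, abs_of_pos (half_pos hρ0)]))
      have : x + (-(ρ / 2)) • u - x₀ = (r - ρ / 2) • u := by
        rw [add_sub_right_comm, hxu, ← add_smul]; congr 1
      rw [dist_eq_norm, this, norm_smul, hun, Real.norm_of_nonneg (by linarith [hρ.2])]
      linarith
    · refine notMem_densityPoints_one measurableSet_ball (c := fun ρ => x + (ρ / 2) • u) ?_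
      filter_upwards [self_mem_nhdsWithin] with ρ hρ
      have hρ0 : 0 < ρ := hρ
      refine subset_inter (fun y hy hy' => ?_) (hball ρ hρ _ (abs_of_pos (half_pos hρ0)))
      have : x + (ρ / 2) • u - x₀ = (r + ρ / 2) • u := by
        rw [add_sub_right_comm, hxu, ← add_smul]
      have h1 : dist (x + (ρ / 2) • u) x₀ = r + ρ / 2 := by
        rw [dist_eq_norm, this, norm_smul, hun, Real.norm_of_nonneg (by positivity), mul_one]
      rw [mem_ball] at hy hy'
      have := dist_triangle_left (x + (ρ / 2) • u) x₀ y
      linarith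

end EssentialBoundary

/-! ### The fractional variation of a ball and its normal -/

section Ball

variable {n : ℕ} {α : ℝ} {x₀ : Rn n} {r : ℝ}

theorem integrable_fracGrad {f : Rn n → ℝ} (hG : Integrable (fun p : Rn n × Rn n =>
    (f (p.1 + p.2) - f p.1) • fracKernel α p.2) (volume.prod volume)) :
    Integrable (fracGrad α f) := by
  refine (hG.integral_prod_left.smul (muConst n α)).congr (Eventually.of_forall fun x => ?_)
  exact (fracGrad_eq_integral_kernel α f x).symm

theorem measurable_fracGrad {f : Rn n → ℝ} (hf : Measurable f) : Measurable (fracGrad α f) := by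
  have hk := measurable_fracKernel (n := n) α
  have h : Measurable (Function.uncurry fun x z : Rn n => (f (x + z) - f x) • fracKernel α z) := by
    unfold Function.uncurry
    fun_prop
  have h1 := (h.stronglyMeasurable.integral_prod_right (ν := volume)).measurable.const_smul
    (muConst n α)
  convert! h1 using 1
  ext1 x
  exact fracGrad_eq_integral_kernel α f x

theorem integrable_prod_chi_ball (hn : 1 ≤ n) (hα₀ : 0 < α) (hα₁ : α < 1) (x₀ : Rn n) (hr : 0 < r) :
    Integrable (fun p : Rn n × Rn n =>
      (chi (ball x₀ r) (p.1 + p.2) - chi (ball x₀ r) p.1) • fracKernel α p.2)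
      (volume.prod volume) := by
  obtain ⟨C, _, hC⟩ := exists_integral_abs_chi_ball_add_sub_le hn x₀ hr
  exact integrable_prod_sub_smul_fracKernel hn hα₀ hα₁ (measurable_chi measurableSet_ball)
    (integrable_chi_ball x₀ r) hC

theorem chi_ball_reflect (x₀ v : Rn n) (r : ℝ) :
    chi (ball x₀ r) (x₀ + -v) = chi (ball x₀ r) (x₀ + v) := by
  rw [chi_ball_add, chi_ball_add]
  unfold chi
  by_cases h : ‖v‖ < r
  · rw [indicator_of_mem (by simpa using h), indicator_of_mem (by simpa using h)]
  · rw [indicator_of_notMem (by simpa using h), indicator_of_notMem (by simpa using h)]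

/-- The ball is symmetric about its centre and the kernel is odd. -/
theorem fracGrad_ball_reflect (α : ℝ) (x₀ z : Rn n) (r : ℝ) :
    fracGrad α (chi (ball x₀ r)) (x₀ + -z) = -fracGrad α (chi (ball x₀ r)) (x₀ + z) := by
  rw [fracGrad_eq_integral_kernel, fracGrad_eq_integral_kernel, ← smul_neg, ← integral_neg,
    ← integral_neg_eq_self]
  congr 2
  ext1 w
  have : x₀ + -z + -w = x₀ + -(z + w) := by abel
  rw [this, chi_ball_reflect, chi_ball_reflect, fracKernel_neg, smul_neg, add_assoc]

theorem setIntegral_fracGrad_ball_center (α : ℝ) (x₀ : Rn n) (r ρ : ℝ) :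
    ∫ x in ball x₀ ρ, fracGrad α (chi (ball x₀ r)) x = 0 := by
  set F : Rn n → Rn n := fun z =>
    (ball x₀ ρ).indicator (fracGrad α (chi (ball x₀ r))) (x₀ + z) with hF
  have hodd : ∀ z, F (-z) = -F z := fun z => by
    simp only [hF]
    by_cases h : ‖z‖ < ρ
    · rw [indicator_of_mem (by simpa using h), indicator_of_mem (by simpa using h),
        fracGrad_ball_reflect]
    · rw [indicator_of_notMem (by simpa using h), indicator_of_notMem (by simpa using h), neg_zero]
  have h1 := integral_neg_eq_self F volume
  simp_rw [hodd] at h1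
  rw [integral_neg] at h1
  rw [← integral_indicator measurableSet_ball, ← integral_add_left_eq_self _ x₀]
  have h2 : (∫ z, F z) + ∫ z, F z = 0 := by
    nth_rewrite 1 [← h1]
    exact neg_add_cancel _
  rw [← two_smul ℝ] at h2
  exact (smul_eq_zero.1 h2).resolve_left two_ne_zero

/-- The inward radial field of unit length. -/
noncomputable def inwardNormal (x₀ x : Rn n) : Rn n := -(‖x - x₀‖⁻¹ • (x - x₀))

theorem measurable_inwardNormal (x₀ : Rn n) : Measurable (inwardNormal x₀) := by
  unfold inwardNormal
  fun_prop

theorem norm_inwardNormal {x₀ x : Rn n} (h : x ≠ x₀) : ‖inwardNormal x₀ x‖ = 1 := by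
  have h0 : ‖x - x₀‖ ≠ 0 := norm_ne_zero_iff.2 (sub_ne_zero.2 h)
  rw [inwardNormal, norm_neg, norm_smul, norm_inv, norm_norm, inv_mul_cancel₀ h0]

/-- The centre and the sphere are null sets, so the pointwise description yields the polar
decomposition of the measure with density `∇^α χ`. -/
theorem ae_fracGrad_ball (hn : 1 ≤ n) (hα₀ : 0 < α) (hα₁ : α < 1) (x₀ : Rn n) (hr : 0 < r) :
    ∀ᵐ x, x ≠ x₀ ∧ fracGrad α (chi (ball x₀ r)) x ≠ 0 ∧ fracGrad α (chi (ball x₀ r)) x =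
      ‖fracGrad α (chi (ball x₀ r)) x‖ • inwardNormal x₀ x := by
  have : Nontrivial (Rn n) :=
    Module.nontrivial_of_finrank_pos (R := ℝ) (by simpa using Nat.zero_lt_of_lt hn)
  have h1 : ∀ᵐ x : Rn n, x ≠ x₀ := by simp [ae_iff]
  have h2 : ∀ᵐ x : Rn n, x ∉ sphere x₀ r := by
    have : volume (sphere x₀ r) = 0 := Measure.addHaar_sphere _ _ _
    exact measure_eq_zero_iff_ae_notMem.1 this
  filter_upwards [h1, h2] with x hx hxs
  exact ⟨hx, exists_fracGrad_ball_eq_neg_smul hα₀ hα₁ hr hxs hx⟩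

/-- The total variation of the fractional variation of a ball. -/
noncomputable def ballVariation (α : ℝ) (x₀ : Rn n) (r : ℝ) : Measure (Rn n) :=
  volume.withDensity fun x => ENNReal.ofReal ‖fracGrad α (chi (ball x₀ r)) x‖

theorem isFiniteMeasure_ballVariation (hn : 1 ≤ n) (hα₀ : 0 < α) (hα₁ : α < 1) (x₀ : Rn n)
    (hr : 0 < r) : IsFiniteMeasure (ballVariation α x₀ r) :=
  isFiniteMeasure_withDensity_ofReal
    (integrable_fracGrad (integrable_prod_chi_ball hn hα₀ hα₁ x₀ hr)).norm.hasFiniteIntegral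

theorem measurable_ofReal_norm_fracGrad (α : ℝ) (x₀ : Rn n) (r : ℝ) :
    Measurable fun x => ENNReal.ofReal ‖fracGrad α (chi (ball x₀ r)) x‖ :=
  (measurable_fracGrad (measurable_chi measurableSet_ball)).norm.ennreal_ofReal

/-- The fractional variation of a ball. -/
noncomputable def ballFracVariation (hn : 1 ≤ n) (hα₀ : 0 < α) (hα₁ : α < 1) (x₀ : Rn n)
    (hr : 0 < r) : VectorRadonMeasure n where
  variation := ballVariation α x₀ r
  locallyFinite := by
    have := isFiniteMeasure_ballVariation hn hα₀ hα₁ x₀ hr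
    infer_instance
  density := inwardNormal x₀
  measurable_density := measurable_inwardNormal x₀
  norm_density := by
    refine (withDensity_absolutelyContinuous volume _).ae_le ?_
    filter_upwards [ae_fracGrad_ball hn hα₀ hα₁ x₀ hr] with x hx
    exact norm_inwardNormal hx.1

theorem isFracVariation_ballFracVariation (hn : 1 ≤ n) (hα₀ : 0 < α) (hα₁ : α < 1) (x₀ : Rn n)
    (hr : 0 < r) :
    IsFracVariation α (chi (ball x₀ r)) (ballFracVariation hn hα₀ hα₁ x₀ hr) := by
  intro φ hφ hc
  rw [integral_mul_fracDiv hn hα₀ hα₁ (integrable_chi_ball x₀ r)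
    (integrable_prod_chi_ball hn hα₀ hα₁ x₀ hr) hφ hc]
  congr 1
  simp only [ballFracVariation, ballVariation]
  rw [integral_withDensity_eq_integral_toReal_smul (measurable_ofReal_norm_fracGrad α x₀ r)
    (Eventually.of_forall fun x => ENNReal.ofReal_lt_top)]
  refine integral_congr_ae ?_
  filter_upwards [ae_fracGrad_ball hn hα₀ hα₁ x₀ hr] with x hx
  -- Modulus times inward normal reassembles the fractional gradient.
  rw [ENNReal.toReal_ofReal (norm_nonneg _), smul_eq_mul, ← inner_smul_right, ← hx.2.2]

theorem isFracVariation_fracVariation {f : Rn n → ℝ} {D : VectorRadonMeasure n}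
    (h : IsFracVariation α f D) : IsFracVariation α f (fracVariation α f) := by
  have h' : ∃ D, IsFracVariation α f D := ⟨D, h⟩
  rw [fracVariation, dif_pos h']
  exact Classical.choose_spec h'

theorem IsFracVariation.unique {f : Rn n → ℝ} {D₁ D₂ : VectorRadonMeasure n}
    (h₁ : IsFracVariation α f D₁) (h₂ : IsFracVariation α f D₂) :
    D₁.variation = D₂.variation ∧ D₁.density =ᵐ[D₁.variation] D₂.density :=
  VectorRadonMeasure.eq_of_forall_integral_inner_eq fun φ hφ hc =>
    neg_injective ((h₁ φ hφ hc).symm.trans (h₂ φ hφ hc))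

/-- Uniqueness replaces the arbitrarily chosen variation measure by the explicit one. -/
theorem normalQuotient_ball (hn : 1 ≤ n) (hα₀ : 0 < α) (hα₁ : α < 1) (x₀ : Rn n) (hr : 0 < r)
    (x : Rn n) (ρ : ℝ) :
    normalQuotient α (ball x₀ r) x ρ = ((ballVariation α x₀ r).real (ball x ρ))⁻¹ •
      ∫ y in ball x ρ, inwardNormal x₀ y ∂(ballVariation α x₀ r) := by
  have hD := isFracVariation_ballFracVariation hn hα₀ hα₁ x₀ hr
  obtain ⟨h1, h2⟩ := hD.unique (isFracVariation_fracVariation hD)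
  have h3 : ballVariation α x₀ r = (fracVariation α (chi (ball x₀ r))).variation := h1
  have h4 : inwardNormal x₀ =ᵐ[ballVariation α x₀ r]
    (fracVariation α (chi (ball x₀ r))).density := h2
  rw [normalQuotient, VectorRadonMeasure.value, ← h3, integral_congr_ae (ae_restrict_of_ae h4)]

/-- The density is nonzero almost everywhere, so a null set of the variation is Lebesgue null. Hence
the support is the whole space. -/
theorem ballVariation_pos_of_mem_nhds (hn : 1 ≤ n) (hα₀ : 0 < α) (hα₁ : α < 1) (x₀ : Rn n)
    (hr : 0 < r) {x : Rn n} {U : Set (Rn n)} (hU : U ∈ 𝓝 x) : ballVariation α x₀ r U ≠ 0 := by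
  have h : volume ≪ ballVariation α x₀ r :=
    withDensity_absolutelyContinuous' (measurable_ofReal_norm_fracGrad α x₀ r).aemeasurable (by
      filter_upwards [ae_fracGrad_ball hn hα₀ hα₁ x₀ hr] with y hy
      exact (ENNReal.ofReal_pos.2 (norm_pos_iff.2 hy.2.1)).ne')
  exact fun h0 => (volume.measure_pos_of_mem_nhds hU).ne' (h h0)

/-- The quotient is an average of the inward normal, which is continuous away from the centre. -/
theorem tendsto_normalQuotient_ball (hn : 1 ≤ n) (hα₀ : 0 < α) (hα₁ : α < 1) (x₀ : Rn n)
    (hr : 0 < r) {x : Rn n} (hx : x ≠ x₀) :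
    Tendsto (normalQuotient α (ball x₀ r) x) (𝓝[>] 0) (𝓝 (inwardNormal x₀ x)) := by
  have := isFiniteMeasure_ballVariation hn hα₀ hα₁ x₀ hr
  simp only [funext (normalQuotient_ball hn hα₀ hα₁ x₀ hr x)]
  refine tendsto_average_ball (fun ρ hρ => ballVariation_pos_of_mem_nhds hn hα₀ hα₁ x₀ hr
    (ball_mem_nhds x hρ)) ?_ ?_
  · refine Integrable.of_bound (measurable_inwardNormal x₀).aestronglyMeasurable 1
      (Eventually.of_forall fun y => ?_)
    rcases eq_or_ne y x₀ with rfl | hy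
    · simp [inwardNormal]
    · exact (norm_inwardNormal hy).le
  · have h0 : ‖x - x₀‖ ≠ 0 := norm_ne_zero_iff.2 (sub_ne_zero.2 hx)
    unfold inwardNormal
    fun_prop (disch := assumption)

/-- By oddness the measure of a ball about `x₀` is zero, so the limit there is zero rather than a
unit vector. -/
theorem normalQuotient_ball_center (hn : 1 ≤ n) (hα₀ : 0 < α) (hα₁ : α < 1) (x₀ : Rn n)
    (hr : 0 < r) (ρ : ℝ) : normalQuotient α (ball x₀ r) x₀ ρ = 0 := by
  rw [normalQuotient_ball hn hα₀ hα₁ x₀ hr, ballVariation,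
    setIntegral_withDensity_eq_setIntegral_toReal_smul (measurable_ofReal_norm_fracGrad α x₀ r)
    (Eventually.of_forall fun x => ENNReal.ofReal_lt_top) _ measurableSet_ball]
  have : ∫ y in ball x₀ ρ, (ENNReal.ofReal ‖fracGrad α (chi (ball x₀ r)) y‖).toReal •
      inwardNormal x₀ y = ∫ y in ball x₀ ρ, fracGrad α (chi (ball x₀ r)) y := by
    refine integral_congr_ae (ae_restrict_of_ae ?_)
    filter_upwards [ae_fracGrad_ball hn hα₀ hα₁ x₀ hr] with y hy
    rw [ENNReal.toReal_ofReal (norm_nonneg _), ← hy.2.2]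
  rw [this, setIntegral_fracGrad_ball_center, smul_zero]

theorem fracReducedBoundary_ball (hn : 1 ≤ n) (hα₀ : 0 < α) (hα₁ : α < 1) (x₀ : Rn n)
    (hr : 0 < r) : fracReducedBoundary α (ball x₀ r) = {x₀}ᶜ := by
  ext x
  rw [mem_compl_singleton_iff]
  constructor
  · rintro ⟨_, ν, hν, hlim⟩ rfl
    rw [funext (normalQuotient_ball_center hn hα₀ hα₁ x hr)] at hlim
    rw [← tendsto_nhds_unique tendsto_const_nhds hlim, norm_zero] at hν
    exact zero_ne_one hν
  · intro hx
    refine ⟨?_, _, norm_inwardNormal hx, tendsto_normalQuotient_ball hn hα₀ hα₁ x₀ hr hx⟩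
    have hD := isFracVariation_ballFracVariation hn hα₀ hα₁ x₀ hr
    have h1 : ballVariation α x₀ r = (fracVariation α (chi (ball x₀ r))).variation :=
      (hD.unique (isFracVariation_fracVariation hD)).1
    rw [← h1, Measure.mem_support_iff_forall]
    exact fun U hU => pos_iff_ne_zero.2 (ballVariation_pos_of_mem_nhds hn hα₀ hα₁ x₀ hr hU)

/-- After integration by parts, the `L¹` norm of the fractional gradient bounds the supremum,
uniformly in `A`. -/
theorem memBVLoc_chi_ball (hn : 1 ≤ n) (hα₀ : 0 < α) (hα₁ : α < 1) (x₀ : Rn n) (hr : 0 < r) :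
    MemBVLoc α ⊤ (chi (ball x₀ r)) := by
  refine ⟨memLp_top_of_bound (measurable_chi measurableSet_ball).aestronglyMeasurable 1
    (Eventually.of_forall fun x => ?_), fun A _ _ =>
      ⟨∫ x, ‖fracGrad α (chi (ball x₀ r)) x‖, ?_⟩⟩
  · refine (norm_indicator_le_norm_self _ _).trans ?_
    simp
  · rintro _ ⟨φ, hφ, hc, hφ1, _, rfl⟩
    have hG := integrable_prod_chi_ball hn hα₀ hα₁ x₀ hr
    rw [integral_mul_fracDiv hn hα₀ hα₁ (integrable_chi_ball x₀ r) hG hφ hc]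
    refine (le_abs_self _).trans ?_
    rw [abs_neg, ← Real.norm_eq_abs]
    refine norm_integral_le_of_norm_le (integrable_fracGrad hG).norm
      (Eventually.of_forall fun x => ?_)
    refine (norm_inner_le_norm _ _).trans (mul_le_of_le_one_left (norm_nonneg _) (hφ1 x))

end Ball

end FractionalBV

theorem mainTheorem11 (n : ℕ) (hn : 1 ≤ n) (α : ℝ) (hα₀ : 0 < α) (hα₁ : α < 1)
    (x₀ : FractionalBV.Rn n) (r : ℝ) (hr : 0 < r) :
    (∀ x : FractionalBV.Rn n, x ∉ sphere x₀ r →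
      Integrable (FractionalBV.fracGradIntegrand α (FractionalBV.chi (ball x₀ r)) x) volume ∧
      IntegrableOn
        (fun y => (‖x - y‖ ^ ((n : ℝ) + α - 1))⁻¹ • ((1 / r) • (y - x₀)))
        (sphere x₀ r) (Measure.euclideanHausdorffMeasure (n - 1)) ∧
      FractionalBV.fracGrad α (FractionalBV.chi (ball x₀ r)) x =
        -(FractionalBV.muConst n α / ((n : ℝ) + α - 1)) •
          ∫ y in sphere x₀ r, (‖x - y‖ ^ ((n : ℝ) + α - 1))⁻¹ • ((1 / r) • (y - x₀))
            ∂(Measure.euclideanHausdorffMeasure (n - 1))) ∧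
    FractionalBV.MemBVLoc α ⊤ (FractionalBV.chi (ball x₀ r)) ∧
    FractionalBV.IsFracVariation α (FractionalBV.chi (ball x₀ r))
      (FractionalBV.fracVariation α (FractionalBV.chi (ball x₀ r))) ∧
    FractionalBV.fracReducedBoundary α (ball x₀ r) = {x₀}ᶜ ∧
    FractionalBV.effFracReducedBoundary α (ball x₀ r) = sphere x₀ r ∧
    ∀ x : FractionalBV.Rn n, x ≠ x₀ →
      FractionalBV.fracNormal α (ball x₀ r) x = -(‖x - x₀‖⁻¹ • (x - x₀)) := by
  have hD := FractionalBV.isFracVariation_ballFracVariation hn hα₀ hα₁ x₀ hr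
  have hF := FractionalBV.fracReducedBoundary_ball hn hα₀ hα₁ x₀ hr
  refine ⟨fun x hx => ⟨FractionalBV.integrable_fracGradIntegrand_ball hα₀ hx,
    FractionalBV.fracGrad_ball_eq_integral_sphere hn hα₀ hr hx⟩,
    FractionalBV.memBVLoc_chi_ball hn hα₀ hα₁ x₀ hr,
    FractionalBV.isFracVariation_fracVariation hD, hF, ?_, fun x hx =>
      (FractionalBV.tendsto_normalQuotient_ball hn hα₀ hα₁ x₀ hr hx).limUnder_eq⟩
  rw [FractionalBV.effFracReducedBoundary, hF, FractionalBV.essBoundary_ball x₀ hr]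
  refine inter_eq_right.2 fun x hx => ?_
  rw [mem_compl_singleton_iff]
  rintro rfl
  rw [mem_sphere, dist_self] at hx
  exact hr.ne hx
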